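/- Strings are finite binary strings, $\ell(x)$ is the length of $x$, and logarithms are to base $2$. Fix a universal prefix computer $U(p,y)$ (a program $p$ with an input $y$; for each $y$ the set of halting programs is prefix-free), and write $U(p)$ for empty input. $K(a)$ denotes the prefix complexity of $a$, the minimal length of a program $p$ with $U(p)=a$, where $a$ is a string, a natural number, or a finite set of strings (printed as a list). For a real $r\ge 0$, $K(r)$ is the minimal length of a program that on input $m\in\mathbb N$ outputs $r$ with accuracy $2^{-m}$ ($K(r)=\infty$ if $r$ is not computable). $K_*(a|n)$ is the minimal length of a program $p$ with $U(p,n^*)=a$, where $n^*$ is the (first) shortest program for $n$. An ensemble $\mathbb E$ is a computable probability distribution on strings with finite and computable entropy $H(\mathbb E)=-\sum_s\mathbb E(s)\log\mathbb E(s)$; $K(\mathbb E)$ is the minimal length of a program that computes both $\mathbb E(s)$ (from $s$) and $H(\mathbb E)$ to any prescribed accuracy $2^{-m}$. For real $\delta,\Delta\ge 0$ the effective complexity is $$\mathcal E_{\delta,\Delta}(x)=\inf\{K(\mathbb E) : \mathbb E(x)\ge 2^{-H(\mathbb E)(1+\delta)},\ K(\mathbb E)+H(\mathbb E)\le K(x)+\Delta\},$$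 with $\inf\emptyset=\infty$. For a string $x$ of length $n$ and $k\in\mathbb N$ let $$H_k(x|n)=\min\{\log\#A : x\in A\subseteq\{0,1\}^n,\ K_*(A|n)\le k\}$$ (infinite if there is no such $A$), and let $A_k$ be the first minimizing set in a fixed canonical order. Let $k_\Delta(x)$ be the minimal $k\in\mathbb N$ such that $H_k(x|n)$ is finite and $H_k(x|n)+k\le K_*(x|n)+\Delta$, and let $k^*_\Delta(x)$ (the Kolmogorov minimal sufficient statistics) be a shortest program for $A_{k_\Delta(x)}$. If no such $k$ exists, put $k_\Delta(x)=\ell(k^*_\Delta(x))=\infty$. **Lemma.** (1) There are constants $c,C\in\mathbb N$ such that for all real $\delta,\Delta\ge 0$ and all strings $x$, with $n=\ell(x)$, $$\mathcal E_{\delta,\Delta+c}(x)\le \ell(k^*_\Delta(x))+C\quad\text{and}\quad \ell(k^*_\Delta(x))\le k_\Delta(x)+K(n)+C.$$ (2) There are constants $g,C\in\mathbb N$ such that for all real $\delta,\Delta\ge 0$ and all strings $x$, with $n=\ell(x)$ and $D=K(n)+\Delta+\delta\,(K(x)+\Delta)+K(\delta)+g$, $$k_D(x)\le \mathcal E_{\delta,\Delta}(x)+K(\delta)+C\quad\text{and}\quad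 \ell(k^*_D(x))\le k_D(x)+K(n)+C.$$ In particular, for computable $\delta$, up to additive constants, $\mathcal E_{\delta,\Delta}(x)\ge k_D(x)-K(\delta)\ge \ell(k^*_D(x))-K(\delta)-K(n)$. (The first inequality in (2) is trivially true if $K(\delta)=\infty$.) The constants depend only on $U$. -/

import Mathlib

open scoped NNReal ENNReal

noncomputable section

namespace EffComp

/-! Finite binary strings are `List Bool`; `x.length` is the length of `x`.
All complexities take values in `ℕ∞`, with `⊤` when there is no program. -/

/-- A prefix computer: a partial computable function of a program `p` and an input `y` such that,
for each input, no proper extension of a halting program halts. -/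
structure IsPrefixComputer (V : List Bool → List Bool →. List Bool) : Prop where
  partrec : Partrec₂ V
  prefix_free : ∀ y p t : List Bool, (V p y).Dom → t ≠ [] → ¬ (V (p ++ t) y).Dom

/-- A universal prefix computer: it simulates every prefix computer `V`, the translation of a
program being independent of the input and lengthening it by at most a constant. -/
structure IsUniversalPrefixComputer (U : List Bool → List Bool →. List Bool) : Prop
    extends IsPrefixComputer U where
  universal : ∀ V : List Bool → List Bool →. List Bool, IsPrefixComputer V →
    ∃ c : ℕ, ∀ p : List Bool, ∃ q : List Bool, q.length ≤ p.length + c ∧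
      ∀ y x : List Bool, x ∈ V p y → x ∈ U q y

/-- The minimal length of a string in `S` (`⊤` if `S` is empty). -/
def minLength (S : Set (List Bool)) : ℕ∞ := ⨅ p ∈ S, (p.length : ℕ∞)

/-- The binary digits of a natural number. -/
def natCode (n : ℕ) : List Bool := Nat.bits n

/-- The string coding a finite list of strings. -/
def listCode (l : List (List Bool)) : List Bool := natCode (Encodable.encode l)

/-- Program `p` with input `y` computes a listing of the elements of the finite set `A`
and halts. -/
def Lists (U : List Bool → List Bool →. List Bool) (p y : List Bool) (A : Finset (List Bool)) :
    Prop :=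
  ∃ l : List (List Bool), l.toFinset = A ∧ listCode l ∈ U p y

/-- Program `p` with input `y` outputs (in binary) a natural number `m` such that the dyadic
rational `m / 2 ^ n` approximates the nonnegative real `r` with accuracy `2 ^ (-n)`. -/
def Approximates (U : List Bool → List Bool →. List Bool) (p y : List Bool) (r : ℝ) (n : ℕ) :
    Prop :=
  ∃ m : ℕ, natCode m ∈ U p y ∧ |r - (m : ℝ) / 2 ^ n| ≤ 1 / 2 ^ n

/-! ### Prefix complexity of strings, natural numbers, finite sets and real numbers -/

/-- `K(x)` for a string `x`; the input is empty. -/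
def stringK (U : List Bool → List Bool →. List Bool) (x : List Bool) : ℕ∞ :=
  minLength {p | x ∈ U p []}

/-- `K(n)` for a natural number `n`. -/
def natK (U : List Bool → List Bool →. List Bool) (n : ℕ) : ℕ∞ := stringK U (natCode n)

/-- `K(r)` for a nonnegative real `r`: the minimal length of a program that, on input `n`, outputs
an approximation of `r` with accuracy `2 ^ (-n)`. It is `⊤` iff `r` is not computable. -/
def realK (U : List Bool → List Bool →. List Bool) (r : ℝ) : ℕ∞ :=
  minLength {p | ∀ n : ℕ, Approximates U p (natCode n) r n}

/-- `s` is the minimal program `y^*` of the string `y`: the first one in the length-lexicographic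
order (in particular, a shortest one). -/
def IsStar (U : List Bool → List Bool →. List Bool) (y s : List Bool) : Prop :=
  y ∈ U s [] ∧ ∀ q : List Bool, y ∈ U q [] → q = s ∨ List.Shortlex (· < ·) s q

/-- Chaitin's conditional complexity `K_*(x | n)`: a minimal program `n^*` of `n` is given. -/
def stringKStar (U : List Bool → List Bool →. List Bool) (x : List Bool) (n : ℕ) : ℕ∞ :=
  minLength {p | ∃ s, IsStar U (natCode n) s ∧ x ∈ U p s}

/-- `K_*(A | n)` for a finite set `A` of strings. -/
def setKStar (U : List Bool → List Bool →. List Bool) (A : Finset (List Bool)) (n : ℕ) : ℕ∞ :=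
  minLength {p | ∃ s, IsStar U (natCode n) s ∧ Lists U p s A}

/-! ### Ensembles and effective complexity -/

/-- The terms `E(s) log₂ E(s)` of the entropy series. -/
def entropyTerm (E : PMF (List Bool)) (s : List Bool) : ℝ :=
  (E s).toReal * Real.logb 2 (E s).toReal

/-- The entropy `H(E) = - ∑ E(s) log₂ E(s)` (meaningful for ensembles of finite entropy). -/
def entropy (E : PMF (List Bool)) : ℝ := -∑' s, entropyTerm E s

/-- Code of a query to a program for an ensemble: `(some s, n)` asks for `E(s)` and `(none, n)`
asks for `H(E)`, both with accuracy `2 ^ (-n)`. -/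
def queryCode (q : Option (List Bool) × ℕ) : List Bool := natCode (Encodable.encode q)

/-- Program `p` computes the ensemble `E` and contains a subprogram computing its entropy. -/
def ComputesEnsemble (U : List Bool → List Bool →. List Bool) (p : List Bool)
    (E : PMF (List Bool)) : Prop :=
  (∀ (s : List Bool) (n : ℕ), Approximates U p (queryCode (some s, n)) (E s).toReal n) ∧
    ∀ n : ℕ, Approximates U p (queryCode (none, n)) (entropy E) n

/-- `K(E)`, the complexity of an ensemble together with its entropy. It is finite iff `E` is
computable with computable entropy. -/
def ensembleK (U : List Bool → List Bool →. List Bool) (E : PMF (List Bool)) : ℕ∞ :=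
  minLength {p | ComputesEnsemble U p E}

/-- The total information `Σ(E) = K(E) + H(E)`. -/
def totalInfo (U : List Bool → List Bool →. List Bool) (E : PMF (List Bool)) : ℝ≥0∞ :=
  (ensembleK U E : ℝ≥0∞) + ENNReal.ofReal (entropy E)

/-- `x` is `δ`-typical for `E`. -/
def IsTypical (δ : ℝ≥0) (x : List Bool) (E : PMF (List Bool)) : Prop :=
  (2 : ℝ) ^ (-(entropy E * (1 + (δ : ℝ)))) ≤ (E x).toReal

/-- The minimization domain of `x`: computable ensembles with finite and computable entropy for
which `x` is `δ`-typical and `Σ(E) ≤ K(x) + Δ`. -/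
def minDomain (U : List Bool → List Bool →. List Bool) (δ Δ : ℝ≥0) (x : List Bool) :
    Set (PMF (List Bool)) :=
  {E | Summable (entropyTerm E) ∧ ensembleK U E ≠ ⊤ ∧ IsTypical δ x E ∧
    totalInfo U E ≤ (stringK U x : ℝ≥0∞) + (Δ : ℝ≥0∞)}

/-- The effective complexity of `x` (`⊤` if the minimization domain is empty). -/
def effComplexity (U : List Bool → List Bool →. List Bool) (δ Δ : ℝ≥0) (x : List Bool) : ℕ∞ :=
  ⨅ E ∈ minDomain U δ Δ x, ensembleK U E

/-! ### Structure function and Kolmogorov minimal sufficient statistics -/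

/-- The sets over which the structure function minimizes: `x ∈ A ⊆ {0,1}^n` and `K_*(A | n) ≤ k`,
where `n` is the length of `x`. -/
def structureSets (U : List Bool → List Bool →. List Bool) (x : List Bool) (k : ℕ) :
    Set (Finset (List Bool)) :=
  {A | x ∈ A ∧ (∀ a ∈ A, a.length = x.length) ∧ setKStar U A x.length ≤ (k : ℕ∞)}

/-- The base-two logarithm of the cardinality of a set (used for nonempty sets). -/
def logCard (A : Finset (List Bool)) : ℝ≥0∞ := ENNReal.ofReal (Real.logb 2 (A.card : ℝ))

/-- The structure function `H_k(x | n)`, `n` the length of `x` (`⊤` if there is no set to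
minimize over). -/
def structureFn (U : List Bool → List Bool →. List Bool) (x : List Bool) (k : ℕ) : ℝ≥0∞ :=
  ⨅ A ∈ structureSets U x k, logCard A

/-- `A` is the minimizing set `A_k`, the first one in a canonical order if there are several. -/
def IsStructureSet (U : List Bool → List Bool →. List Bool) (x : List Bool) (k : ℕ)
    (A : Finset (List Bool)) : Prop :=
  A ∈ structureSets U x k ∧ logCard A = structureFn U x k ∧
    ∀ B ∈ structureSets U x k, logCard B = structureFn U x k →
      Encodable.encode A ≤ Encodable.encode B

/-- `k_Δ(x)`: the minimal `k` for which `H_k(x | n)` is finite and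
`H_k(x | n) + k ≤ K_*(x | n) + Δ` (`⊤` if there is none). The finiteness is automatic for finite
`Δ`. -/
def kmssIndex (U : List Bool → List Bool →. List Bool) (Δ : ℝ≥0∞) (x : List Bool) : ℕ∞ :=
  ⨅ (k : ℕ) (_ : structureFn U x k ≠ ⊤ ∧
    structureFn U x k + (k : ℝ≥0∞) ≤ (stringKStar U x x.length : ℝ≥0∞) + Δ), (k : ℕ∞)

/-- `p` is a Kolmogorov minimal sufficient statistic `k^*_Δ(x)`: a minimal program for the set
`A_k`, where `k = k_Δ(x)`. -/
def IsKMSS (U : List Bool → List Bool →. List Bool) (Δ : ℝ≥0∞) (x p : List Bool) : Prop :=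
  ∃ (k : ℕ) (A : Finset (List Bool)), kmssIndex U Δ x = (k : ℕ∞) ∧ IsStructureSet U x k A ∧
    Lists U p [] A ∧ ∀ q : List Bool, Lists U q [] A → p.length ≤ q.length

/-- The length of `k^*_Δ(x)`, which is the same for all choices of the minimal program
(`⊤` if `k_Δ(x)` is `⊤`). -/
def kmssLength (U : List Bool → List Bool →. List Bool) (Δ : ℝ≥0∞) (x : List Bool) : ℕ∞ :=
  minLength {p | IsKMSS U Δ x p}

end EffComp

end

namespace EffComp

/-! Both parts translate between sets and ensembles, and pay for the translation with the chain rule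
$K(x) = K_*(x|n) + K(n) + O(1)$ for $n = \ell(x)$.

From sets to ensembles: the uniform distribution on $A_k$ has entropy $\log \#A_k$, makes every
element of $A_k$ typical for every $\delta \ge 0$, and is computed from any listing of $A_k$
(`exists_uniform`). A program for $A_k$ given $n^*$, preceded by $n^*$, is a program for $A_k$, so
$\ell(k^*) \le k + K(n) + O(1)$ (`kmssLength_le`). Hence the total information is at most $H_k + k +
K(n) + O(1) \le K_*(x|n) + \Delta + K(n) + O(1) \le K(x) + \Delta + O(1)$. The last inequality is
the hard half of the chain rule.

From ensembles to sets: given programs for $\mathbb E$ and $\delta$, and a program for $n$, one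
lists the strings of length $n$ whose approximate probability is about $2^{-H(1+\delta)}$ or more
(`exists_typicalSet`). This set contains $x$, has at most $2^{H(1+\delta)+6}$ elements because the
probabilities sum to at most one, and has conditional complexity at most $K(\mathbb E) + K(\delta) +
O(1)$. The excess $\delta H$ is bounded through $H \le K(\mathbb E) + H \le K(x) + \Delta$, and the
easy half of the chain rule turns $K(x)$ into $K_*(x|n) + K(n)$.

The hard half rests on the Kraft–Chaitin construction (`exists_kraftChaitin`), used twice. First it
gives the coding theorem for lengths: the programs whose output has length $n$ have total weight at
most $O(2^{-K(n)})$ (`exists_sum_le`). Then, given $n^*$, each such program $p$ can be charged only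
$\ell(p) - K(n) + O(1)$ bits without violating the Kraft inequality (`exists_conditional`). -/

variable {U : List Bool → List Bool →. List Bool}

/-! ### Stagewise approximation of partial computable functions -/

/-- `g` is a stagewise approximation of the partial function `V`. -/
structure IsStaging (V : List Bool → List Bool →. List Bool)
    (g : ℕ → List Bool → List Bool → Option (List Bool)) : Prop where
  primrec : Primrec fun z : ℕ × List Bool × List Bool => g z.1 z.2.1 z.2.2
  mem_iff : ∀ p y x, x ∈ V p y ↔ ∃ t, g t p y = some x
  mono : ∀ {t t' p y x}, t ≤ t' → g t p y = some x → g t' p y = some x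

/-- Bounded evaluation of a code for `V` is primitive recursive and monotone in the bound. With such
stages every machine below is an unbounded search over a primitive recursive test. -/
theorem exists_isStaging {V : List Bool → List Bool →. List Bool} (h : Partrec₂ V) :
    ∃ g, IsStaging V g := by
  obtain ⟨c, hc⟩ := Nat.Partrec.Code.exists_code.1 h
  refine ⟨fun t p y => (Nat.Partrec.Code.evaln t c (Encodable.encode (p, y))).bind
    (Encodable.decode (α := List Bool)), ?_, ?_, ?_⟩
  · refine Primrec.option_bind (f := fun z : ℕ × List Bool × List Bool =>
      Nat.Partrec.Code.evaln z.1 c (Encodable.encode z.2)) ?_ ?_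
    · exact Nat.Partrec.Code.primrec_evaln.comp
        (Primrec.pair (Primrec.pair Primrec.fst (Primrec.const c))
          (Primrec.encode.comp Primrec.snd))
    · exact Primrec.decode.comp Primrec.snd
  · intro p y x
    have hev : Nat.Partrec.Code.eval c (Encodable.encode (p, y)) =
        (V p y).map Encodable.encode := by
      rw [hc]; simp
    constructor
    · intro hx
      have : Encodable.encode x ∈ Nat.Partrec.Code.eval c (Encodable.encode (p, y)) := by
        rw [hev]; exact Part.mem_map _ hx
      obtain ⟨t, ht⟩ := Nat.Partrec.Code.evaln_complete.1 this
      refine ⟨t, ?_⟩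
      rw [Option.mem_def] at ht
      rw [ht, Option.bind_some, Encodable.encodek]
    · rintro ⟨t, ht⟩
      obtain ⟨m, hm, hd⟩ := Option.bind_eq_some_iff.1 ht
      have := Nat.Partrec.Code.evaln_sound (Option.mem_def.2 hm)
      rw [hev, Part.mem_map_iff] at this
      obtain ⟨x', hx', rfl⟩ := this
      simp only [Encodable.encodek, Option.some.injEq] at hd
      exact hd ▸ hx'
  · intro t t' p y x htt ht
    obtain ⟨m, hm, hd⟩ := Option.bind_eq_some_iff.1 ht
    exact Option.bind_eq_some_iff.2
      ⟨m, Option.mem_def.1 (Nat.Partrec.Code.evaln_mono htt (Option.mem_def.2 hm)), hd⟩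

namespace IsStaging

variable {V : List Bool → List Bool →. List Bool}
  {g : ℕ → List Bool → List Bool → Option (List Bool)}

theorem dom_iff (hg : IsStaging V g) (p y : List Bool) : (V p y).Dom ↔ ∃ t x, g t p y = some x := by
  constructor
  · intro h
    obtain ⟨t, ht⟩ := (hg.mem_iff p y _).1 (Part.get_mem h)
    exact ⟨t, _, ht⟩
  · rintro ⟨t, x, h⟩
    exact ((hg.mem_iff p y x).2 ⟨t, h⟩).1

theorem mem_of_eq (hg : IsStaging V g) {t p y x} (h : g t p y = some x) : x ∈ V p y :=
  (hg.mem_iff p y x).2 ⟨t, h⟩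

theorem comp_primrec (hg : IsStaging V g) {α : Type*} [Primcodable α] {t : α → ℕ}
    {p y : α → List Bool} (ht : Primrec t) (hp : Primrec p) (hy : Primrec y) :
    Primrec fun a => g (t a) (p a) (y a) :=
  hg.primrec.comp (ht.pair (hp.pair hy))

end IsStaging

/-! ### Binary codes of natural numbers -/

/-- The value of a binary expansion with the least significant digit first. -/
def natVal (l : List Bool) : ℕ := l.foldr (fun b v => 2 * v + b.toNat) 0

theorem natVal_natCode (n : ℕ) : natVal (natCode n) = n := by
  unfold natCode
  induction n using Nat.binaryRec' with
  | zero => simp [natVal]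
  | bit b n h ih =>
    rw [Nat.bits_append_bit n b h]
    have : natVal (b :: n.bits) = 2 * natVal n.bits + b.toNat := rfl
    rw [this, ih, Nat.bit_val]

theorem natCode_injective : Function.Injective natCode :=
  Function.LeftInverse.injective natVal_natCode

theorem primrec_natVal : Primrec natVal := by
  refine Primrec.list_foldr (h := fun _ (z : Bool × ℕ) => 2 * z.2 + z.1.toNat) Primrec.id (Primrec.const 0) ?_
  exact Primrec.nat_add.comp
    (Primrec.nat_mul.comp (Primrec.const 2) (Primrec.snd.comp Primrec.snd))
    ((Primrec.dom_bool Bool.toNat).comp (Primrec.fst.comp Primrec.snd))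

/-- Course-of-values recursion: the digits of `n` are its parity followed by the digits of `n.div2`.
-/
theorem primrec_natCode : Primrec natCode := by
  have : Primrec₂ (fun (_ : Unit) n => natCode n) := by
    refine Primrec.nat_strong_rec _ (g := fun _ l => if l.length = 0 then some [] else
      (l[l.length.div2]?).map (fun b => l.length.bodd :: b)) ?_ ?_
    · have hl : Primrec (fun z : Unit × List (List Bool) => z.2.length) :=
        Primrec.list_length.comp Primrec.snd
      refine Primrec.ite (PrimrecRel.comp Primrec.eq hl (Primrec.const 0)) (Primrec.const _) ?_
      refine Primrec.option_map
        (Primrec.list_getElem?.comp Primrec.snd (Primrec.nat_div2.comp hl)) ?_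
      exact Primrec.list_cons.comp (Primrec.nat_bodd.comp (hl.comp Primrec.fst)) Primrec.snd
    · intro _ n
      by_cases hn : n = 0
      · subst hn; simp [natCode]
      · have hlt : n.div2 < n := by
          rw [Nat.div2_val]; omega
        simp only [List.length_map, List.length_range, hn, if_false]
        simp only [List.getElem?_map, List.getElem?_range hlt, Option.map_some]
        congr 1
        unfold natCode
        conv_rhs => rw [← Nat.bit_bodd_div2 n]
        rw [Nat.bits_append_bit]
        intro h
        by_contra hb
        apply hn
        rw [← Nat.bit_bodd_div2 n, h]
        simp at hb
        simp [hb]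
  exact this.comp (Primrec.const ()) Primrec.id

/-! ### Combining self-delimiting programs -/

theorem IsPrefixComputer.eq_of_append_eq (hU : IsPrefixComputer U) {y s p s' p' : List Bool}
    (h : s ++ p = s' ++ p') (hs : (U s y).Dom) (hs' : (U s' y).Dom) : s = s' := by
  rcases List.append_eq_append_iff.1 h with ⟨t, ht, -⟩ | ⟨t, ht, -⟩
  · by_contra hne
    refine hU.prefix_free y s t hs ?_ (ht ▸ hs')
    rintro rfl; simp_all
  · by_contra hne
    refine hU.prefix_free y s' t hs' ?_ (ht ▸ hs)
    rintro rfl; simp_all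

/-- A universal prefix computer simulates a machine that splits its program into two
self-delimiting parts. -/
theorem IsUniversalPrefixComputer.exists_append (hU : IsUniversalPrefixComputer U)
    (w : ℕ → List Bool → List Bool → List Bool → Option (List Bool))
    (hw : Primrec fun z : ℕ × List Bool × List Bool × List Bool => w z.1 z.2.1 z.2.2.1 z.2.2.2)
    (a : List Bool) (b : List Bool → List Bool)
    (hdom : ∀ t s p y x, w t s p y = some x → (U s a).Dom ∧ (U p (b s)).Dom) :
    ∃ c : ℕ, ∀ s p : List Bool, ∃ q : List Bool, q.length ≤ s.length + p.length + c ∧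
      ∀ t y x, w t s p y = some x → ∃ t' x', w t' s p y = some x' ∧ x' ∈ U q y := by
  -- The search runs over pairs of a stage and a splitting point of the program. By `hdom` both
  -- halves halt on prescribed inputs, so prefix-freeness makes the successful splitting unique. The
  -- stage is not unique, which is why the conclusion only speaks of some `t'`.
  set V : List Bool → List Bool →. List Bool := fun r y => Nat.rfindOpt fun i =>
    w i.unpair.1 (r.take i.unpair.2) (r.drop i.unpair.2) y with hV
  have key : ∀ r y, (V r y).Dom → ∃ t s p x, r = s ++ p ∧ w t s p y = some x := by
    intro r y h
    obtain ⟨i, hi⟩ := Nat.rfindOpt_spec (Part.get_mem h)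
    exact ⟨_, _, _, _, (List.take_append_drop _ _).symm, hi⟩
  have hVp : IsPrefixComputer V := by
    constructor
    · refine Partrec.rfindOpt (f := fun (z : List Bool × List Bool) (i : ℕ) =>
        w i.unpair.1 (z.1.take i.unpair.2) (z.1.drop i.unpair.2) z.2) (Primrec.to_comp ?_)
      have hi : Primrec fun z : (List Bool × List Bool) × ℕ => z.2.unpair :=
        Primrec.unpair.comp Primrec.snd
      have h1 : Primrec fun z : (List Bool × List Bool) × ℕ => z.1.1 :=
        Primrec.fst.comp Primrec.fst
      have h2 : Primrec fun z : (List Bool × List Bool) × ℕ => z.1.2 :=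
        Primrec.snd.comp Primrec.fst
      have hi2 := Primrec.snd.comp hi
      exact hw.comp ((Primrec.fst.comp hi).pair ((Primrec.list_take.comp hi2 h1).pair
        ((Primrec.list_drop.comp hi2 h1).pair h2)))
    · intro y r t h ht h'
      obtain ⟨i, s, p, x, hr, hi⟩ := key _ _ h
      obtain ⟨i', s', p', x', hr', hi'⟩ := key _ _ h'
      have d := hdom _ _ _ _ _ hi
      have d' := hdom _ _ _ _ _ hi'
      rw [hr, List.append_assoc] at hr'
      obtain rfl := hU.eq_of_append_eq hr' d.1 d'.1
      rw [List.append_cancel_left_eq] at hr'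
      exact hU.prefix_free _ _ _ d.2 ht (hr' ▸ d'.2)
  obtain ⟨c, hc⟩ := hU.universal V hVp
  refine ⟨c, fun s p => ?_⟩
  obtain ⟨q, hq, hqV⟩ := hc (s ++ p)
  refine ⟨q, by simpa using hq, fun t y x hx => ?_⟩
  have hd : (V (s ++ p) y).Dom := Nat.rfindOpt_dom.2 ⟨Nat.pair t s.length, x, by simp [hx]⟩
  have hmem := Part.get_mem hd
  obtain ⟨i, hi⟩ := Nat.rfindOpt_spec hmem
  have d := hdom _ _ _ _ _ hx
  have d' := hdom _ _ _ _ _ hi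
  have e : s = (s ++ p).take i.unpair.2 :=
    hU.eq_of_append_eq (p := p) (p' := (s ++ p).drop i.unpair.2) (by simp) d.1 d'.1
  have e' : p = (s ++ p).drop i.unpair.2 := by
    have := List.take_append_drop i.unpair.2 (s ++ p)
    rw [← e, List.append_cancel_left_eq] at this
    exact this.symm
  rw [← e, ← e'] at hi
  exact ⟨_, _, hi, hqV _ _ hmem⟩

/-- Running a program on the output of a preliminary one. -/
theorem IsUniversalPrefixComputer.exists_comp (hU : IsUniversalPrefixComputer U) :
    ∃ c : ℕ, ∀ s p : List Bool, (U s []).Dom →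
      ∃ q : List Bool, q.length ≤ s.length + p.length + c ∧ ∀ x, x ∈ U p s → x ∈ U q [] := by
  obtain ⟨g, hg⟩ := exists_isStaging hU.partrec
  have hw : Primrec fun z : ℕ × List Bool × List Bool × List Bool =>
      if (g z.1 z.2.1 []).isSome then g z.1 z.2.2.1 z.2.1 else none := by
    refine Primrec.ite ?_ ?_ (Primrec.const none)
    · refine PrimrecRel.comp Primrec.eq (Primrec.option_isSome.comp ?_) (Primrec.const true)
      exact hg.comp_primrec Primrec.fst (Primrec.fst.comp Primrec.snd) (Primrec.const [])
    · exact hg.comp_primrec Primrec.fst (Primrec.fst.comp (Primrec.snd.comp Primrec.snd))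
        (Primrec.fst.comp Primrec.snd)
  obtain ⟨c, hc⟩ := hU.exists_append
    (fun t s p _ => if (g t s []).isSome then g t p s else none) hw [] id (by
      intro t s p y x h
      split_ifs at h with h1
      obtain ⟨x₁, h₁⟩ := Option.isSome_iff_exists.1 h1
      exact ⟨(hg.mem_of_eq h₁).1, (hg.mem_of_eq h).1⟩)
  refine ⟨c, fun s p hs => ?_⟩
  obtain ⟨q, hq, h⟩ := hc s p
  refine ⟨q, hq, fun x hx => ?_⟩
  obtain ⟨t₁, x₁, h₁⟩ := (hg.dom_iff _ _).1 hs
  obtain ⟨t₂, h₂⟩ := (hg.mem_iff _ _ _).1 hx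
  obtain ⟨t', x', h', hx'⟩ := h (max t₁ t₂) [] x (by
    simp [hg.mono (le_max_left t₁ t₂) h₁, hg.mono (le_max_right t₁ t₂) h₂])
  split_ifs at h'
  rwa [Part.mem_unique hx (hg.mem_of_eq h')]

/-- Answering queries by means of the output of a program. -/
theorem IsUniversalPrefixComputer.exists_post (hU : IsUniversalPrefixComputer U)
    (f : List Bool → List Bool → List Bool) (hf : Primrec₂ f) :
    ∃ c : ℕ, ∀ p : List Bool, ∃ q : List Bool, q.length ≤ p.length + c ∧
      ∀ w, w ∈ U p [] → ∀ y, f w y ∈ U q y := by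
  have hV : IsPrefixComputer fun p y => (U p []).map fun w => f w y := by
    constructor
    · refine Partrec.map (f := fun z : List Bool × List Bool => U z.1 [])
        (g := fun z w => f w z.2) ?_ ?_
      · exact Partrec₂.comp hU.partrec Computable.fst (Computable.const [])
      · exact (hf.comp Primrec.snd (Primrec.snd.comp Primrec.fst)).to_comp
    · intro y p t h ht h'
      exact hU.prefix_free [] p t h ht h'
  obtain ⟨c, hc⟩ := hU.universal _ hV
  refine ⟨c, fun p => ?_⟩
  obtain ⟨q, hq, h⟩ := hc p
  exact ⟨q, hq, fun w hw y => h _ _ (Part.mem_map _ hw)⟩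

/-! ### Minimal programs -/

theorem minLength_le {S : Set (List Bool)} {p : List Bool} (hp : p ∈ S) :
    minLength S ≤ p.length := iInf₂_le p hp

theorem exists_length_eq_minLength {S : Set (List Bool)} (h : minLength S ≠ ⊤) :
    ∃ p ∈ S, (p.length : ℕ∞) = minLength S ∧ ∀ q ∈ S, p.length ≤ q.length := by
  have hne : S.Nonempty := by
    by_contra hS
    rw [Set.not_nonempty_iff_eq_empty] at hS
    exact h (by simp [minLength, hS])
  obtain ⟨p, hp, hmin⟩ := WellFounded.has_min (measure List.length).wf S hne
  have hmin' : ∀ q ∈ S, p.length ≤ q.length := fun q hq => not_lt.1 (hmin q hq)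
  exact ⟨p, hp, le_antisymm (le_iInf₂ fun q hq => by exact_mod_cast hmin' q hq)
    (minLength_le hp), hmin'⟩

theorem IsUniversalPrefixComputer.exists_program (hU : IsUniversalPrefixComputer U)
    (x : List Bool) : ∃ p, x ∈ U p [] := by
  -- The machine whose only halting program is empty and which prints `x`.
  have hV : IsPrefixComputer fun p _ => ((if p = [] then some x else none : Option _) : Part _) := by
    constructor
    · refine Computable.ofOption (f := fun z : List Bool × List Bool =>
        if z.1 = [] then some x else none) (Primrec.to_comp ?_)
      exact Primrec.ite (PrimrecRel.comp Primrec.eq Primrec.fst (Primrec.const []))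
        (Primrec.const _) (Primrec.const _)
    · intro y p t h ht h'
      have : p ++ t = [] := by
        by_contra hne
        rw [if_neg hne] at h'
        simp at h'
      simp_all
  obtain ⟨c, hc⟩ := hU.universal _ hV
  obtain ⟨q, -, h⟩ := hc []
  exact ⟨q, h [] x (by simp)⟩

theorem IsUniversalPrefixComputer.stringK_ne_top (hU : IsUniversalPrefixComputer U)
    (x : List Bool) : stringK U x ≠ ⊤ := by
  obtain ⟨p, hp⟩ := hU.exists_program x
  exact ne_top_of_le_ne_top (ENat.natCast_ne_top _) (minLength_le (S := {p | x ∈ U p []}) hp)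

theorem IsUniversalPrefixComputer.exists_isStar (hU : IsUniversalPrefixComputer U)
    (x : List Bool) : ∃ s, IsStar U x s := by
  have wf : WellFounded (List.Shortlex (α := Bool) (· < ·)) := List.Shortlex.wf wellFounded_lt
  obtain ⟨s, hs, hmin⟩ := wf.has_min {p | x ∈ U p []} (hU.exists_program x)
  refine ⟨s, hs, fun q hq => ?_⟩
  rcases trichotomous_of (List.Shortlex (α := Bool) (· < ·)) q s with h | h | h
  · exact (hmin q hq h).elim
  · exact Or.inl h
  · exact Or.inr h

theorem IsStar.length_eq {x s : List Bool} (h : IsStar U x s) :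
    (s.length : ℕ∞) = stringK U x := by
  refine le_antisymm (le_iInf₂ fun q hq => ?_) (minLength_le h.1)
  rcases h.2 q hq with rfl | h'
  · rfl
  · rcases List.shortlex_def.1 h' with h'' | h''
    · exact_mod_cast h''.le
    · exact_mod_cast h''.1.le

/-! ### The Kraft inequality and the Kraft–Chaitin construction -/

/-- The Kraft sum of a finite set of halting programs. -/
theorem IsPrefixComputer.kraft (hU : IsPrefixComputer U) (y : List Bool)
    (S : Finset (List Bool)) (hS : ∀ p ∈ S, (U p y).Dom) :
    ∑ p ∈ S, (1 / 2 : ℝ) ^ p.length ≤ 1 := by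
  -- The empty word destroys unique decodability, but if it halts it is the only halting program.
  -- Otherwise prefix-freeness gives unique decodability, peeling off one word at a time.
  by_cases h0 : [] ∈ S
  · have : S = {[]} := by
      refine Finset.eq_singleton_iff_unique_mem.2 ⟨h0, fun p hp => ?_⟩
      exact (hU.eq_of_append_eq (s := []) (p := p) (s' := p) (p' := []) (by simp) (hS _ h0)
        (hS _ hp)).symm
    simp [this]
  · have := InformationTheory.kraft_mcmillan_inequality (S := S) (by
      intro L₁
      induction L₁ with
      | nil =>
        intro L₂ _ h₂ h
        cases L₂ with
        | nil => rfl
        | cons w L =>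
          have hw : w = [] := by simp_all
          exact (h0 (hw ▸ h₂ w (by simp))).elim
      | cons v L ih =>
        intro L₂ h₁ h₂ h
        cases L₂ with
        | nil =>
          have hv : v = [] := by simp_all
          exact (h0 (hv ▸ h₁ v (by simp))).elim
        | cons w L' =>
          simp only [List.flatten_cons] at h
          obtain rfl := hU.eq_of_append_eq h (hS _ (h₁ _ (by simp))) (hS _ (h₂ _ (by simp)))
          rw [List.append_cancel_left_eq] at h
          rw [ih L' (fun u hu => h₁ u (by simp [hu])) (fun u hu => h₂ u (by simp [hu])) h])
    simpa using this

/-- The numerator of `∑ 2 ^ (-l)` over a list, with denominator `2 ^ l.sum`. -/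
def kraftNum (L : List ℕ) : ℕ := L.foldr (fun l z => (z.1 * 2 ^ l + 2 ^ z.2, z.2 + l)) (0, 0) |>.1

theorem foldr_kraft_snd (L : List ℕ) :
    (L.foldr (fun l (z : ℕ × ℕ) => (z.1 * 2 ^ l + 2 ^ z.2, z.2 + l)) (0, 0)).2 = L.sum := by
  induction L with
  | nil => rfl
  | cons l L ih => rw [List.foldr_cons, List.sum_cons, ← ih]; exact add_comm _ _

theorem kraftNum_cons (l : ℕ) (L : List ℕ) :
    kraftNum (l :: L) = kraftNum L * 2 ^ l + 2 ^ L.sum := by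
  simp [kraftNum, foldr_kraft_snd]

theorem kraftNum_div (L : List ℕ) :
    (kraftNum L : ℝ) / 2 ^ L.sum = (L.map fun l => (1 / 2 : ℝ) ^ l).sum := by
  induction L with
  | nil => simp [kraftNum]
  | cons l L ih =>
    rw [List.map_cons, List.sum_cons, List.sum_cons, ← ih, kraftNum_cons]
    push_cast
    rw [pow_add, one_div, inv_pow]
    field_simp
    ring

theorem primrec_two_pow : Primrec fun n : ℕ => 2 ^ n :=
  (Primrec₂.unpaired'.1 Nat.Primrec.pow).comp (Primrec.const 2) Primrec.id

theorem primrec_foldr_kraft : Primrec fun L : List ℕ =>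
    L.foldr (fun l (z : ℕ × ℕ) => (z.1 * 2 ^ l + 2 ^ z.2, z.2 + l)) (0, 0) := by
  refine Primrec.list_foldr (h := fun _ (z : ℕ × ℕ × ℕ) =>
    (z.2.1 * 2 ^ z.1 + 2 ^ z.2.2, z.2.2 + z.1)) Primrec.id (Primrec.const _) ?_
  have h : Primrec fun z : List ℕ × ℕ × ℕ × ℕ => z.2 := Primrec.snd
  have h1 := Primrec.fst.comp h
  have h2 := Primrec.fst.comp (Primrec.snd.comp h)
  have h3 := Primrec.snd.comp (Primrec.snd.comp h)
  exact (Primrec.nat_add.comp (Primrec.nat_mul.comp h2 (primrec_two_pow.comp h1))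
    (primrec_two_pow.comp h3)).pair (Primrec.nat_add.comp h3 h1)

theorem primrec_kraftNum : Primrec kraftNum := Primrec.fst.comp primrec_foldr_kraft

theorem primrec_list_sum : Primrec fun L : List ℕ => L.sum :=
  (Primrec.snd.comp primrec_foldr_kraft).of_eq foldr_kraft_snd

theorem primrecRel_mem {α : Type*} [Primcodable α] :
    PrimrecRel fun (a : α) (L : List α) => a ∈ L := by
  have h : PrimrecRel fun (L : List α) (a : α) => ∃ b ∈ L, b = a :=
    PrimrecRel.exists_mem_list Primrec.eq
  exact PrimrecRel.of_eq h.swap fun a L => by simp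

/-- The value of a binary expansion with the most significant digit first. -/
def beVal (p : List Bool) : ℕ := p.foldl (fun v b => 2 * v + b.toNat) 0

theorem primrec_beVal : Primrec beVal := by
  refine Primrec.list_foldl (h := fun _ (z : ℕ × Bool) => 2 * z.1 + z.2.toNat) Primrec.id
    (Primrec.const 0) ?_
  exact Primrec.nat_add.comp
    (Primrec.nat_mul.comp (Primrec.const 2) (Primrec.fst.comp Primrec.snd))
    ((Primrec.dom_bool Bool.toNat).comp (Primrec.snd.comp Primrec.snd))

theorem beVal_concat (p : List Bool) (b : Bool) : beVal (p ++ [b]) = 2 * beVal p + b.toNat := by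
  simp [beVal]

theorem beVal_append_bounds (p t : List Bool) :
    beVal p * 2 ^ t.length ≤ beVal (p ++ t) ∧
      beVal (p ++ t) + 1 ≤ (beVal p + 1) * 2 ^ t.length := by
  induction t using List.reverseRecOn with
  | nil => simp
  | append_singleton t b ih =>
    rw [← List.append_assoc, beVal_concat]
    simp only [List.length_append, List.length_singleton, pow_succ]
    have := b.toNat_le
    constructor <;> nlinarith [ih.1, ih.2]

theorem exists_beVal_eq (l z : ℕ) (hz : z < 2 ^ l) : ∃ p : List Bool, p.length = l ∧ beVal p = z := by
  induction l generalizing z with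
  | zero => exact ⟨[], rfl, by simp at hz; simp [beVal, hz]⟩
  | succ l ih =>
    obtain ⟨p, hp, hv⟩ := ih (z / 2) (by rw [pow_succ] at hz; omega)
    refine ⟨p ++ [decide (z % 2 = 1)], by simp [hp], ?_⟩
    rw [beVal_concat, hv]
    rcases Nat.mod_two_eq_zero_or_one z with h | h <;> simp [h] <;> omega

/-! ### Online allocation of code words to enumerated requests -/

/-- The distinct requests enumerated before stage `i`. -/
def requests {α : Type*} [DecidableEq α] (e : ℕ → Option α) (i : ℕ) : List α :=
  i.rec [] fun i L => (e i).elim L fun r => if r ∈ L then L else r :: L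

section requests

variable {α : Type*} [DecidableEq α] (e : ℕ → Option α)

theorem requests_succ (i : ℕ) : requests e (i + 1) =
    (e i).elim (requests e i) fun r =>
      if r ∈ requests e i then requests e i else r :: requests e i := rfl

theorem requests_nodup (i : ℕ) : (requests e i).Nodup := by
  induction i with
  | zero => exact List.nodup_nil
  | succ i ih =>
    rw [requests_succ]
    cases e i with
    | none => exact ih
    | some r =>
      simp only [Option.elim_some]
      split_ifs with h
      · exact ih
      · exact List.nodup_cons.2 ⟨h, ih⟩

theorem mem_requests_iff (i : ℕ) (r : α) : r ∈ requests e i ↔ ∃ j < i, e j = some r := by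
  induction i with
  | zero => simp [requests]
  | succ i ih =>
    have : (∃ j < i + 1, e j = some r) ↔ (e i = some r ∨ r ∈ requests e i) := by
      rw [ih]
      constructor
      · rintro ⟨j, hj, h⟩
        rcases Nat.lt_succ_iff_lt_or_eq.1 hj with hj | rfl
        · exact Or.inr ⟨j, hj, h⟩
        · exact Or.inl h
      · rintro (h | ⟨j, hj, h⟩)
        · exact ⟨i, by omega, h⟩
        · exact ⟨j, by omega, h⟩
    rw [this, requests_succ]
    cases h : e i with
    | none => simp
    | some r' =>
      simp only [Option.elim_some, Option.some.injEq]
      split_ifs with h'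
      · constructor
        · exact Or.inr
        · rintro (rfl | h'')
          · exact h'
          · exact h''
      · simp [eq_comm]

theorem suffix_requests {i j : ℕ} (h : i ≤ j) : requests e i <:+ requests e j := by
  induction j, h using Nat.le_induction with
  | base => exact List.suffix_rfl
  | succ j _ ih =>
    refine ih.trans ?_
    rw [requests_succ]
    cases e j with
    | none => exact List.suffix_rfl
    | some r =>
      simp only [Option.elim_some]
      split_ifs
      · exact List.suffix_rfl
      · exact List.suffix_cons _ _

end requests

theorem primrec_requests {α β : Type*} [Primcodable α] [Primcodable β] [DecidableEq α]
    {e : β → ℕ → Option α} (he : Primrec₂ e) : Primrec₂ fun b i => requests (e b) i := by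
  refine Primrec.nat_rec (f := fun _ => []) (g := fun b (z : ℕ × List α) =>
    (e b z.1).elim z.2 fun r => if r ∈ z.2 then z.2 else r :: z.2) (Primrec.const []) ?_
  have h1 : Primrec fun z : β × ℕ × List α => z.2.2 := Primrec.snd.comp Primrec.snd
  refine (Primrec.option_casesOn (o := fun z : β × ℕ × List α => e z.1 z.2.1)
    (f := fun z => z.2.2) (g := fun z r => if r ∈ z.2.2 then z.2.2 else r :: z.2.2) ?_ h1
    ?_).of_eq ?_
  · exact he.comp Primrec.fst (Primrec.fst.comp Primrec.snd)
  · have h2 : Primrec fun z : (β × ℕ × List α) × α => z.1.2.2 := h1.comp Primrec.fst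
    exact Primrec.ite (PrimrecRel.comp (R := fun (a : α) (L : List α) => a ∈ L) primrecRel_mem Primrec.snd h2) h2
      (Primrec.list_cons.comp Primrec.snd h2)
  · rintro ⟨b, i, L⟩
    cases h : e b i <;> simp [h]

/-- The Kraft sum of a list of requests. -/
noncomputable def weight (L : List (List Bool × ℕ)) : ℝ := (L.map fun r => (1 / 2 : ℝ) ^ r.2).sum

theorem weight_cons (r : List Bool × ℕ) (L : List (List Bool × ℕ)) :
    weight (r :: L) = (1 / 2 : ℝ) ^ r.2 + weight L := by simp [weight]

theorem weight_nonneg (L : List (List Bool × ℕ)) : 0 ≤ weight L :=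
  List.sum_nonneg (by simp only [List.mem_map]; rintro _ ⟨r, -, rfl⟩; positivity)

theorem weight_le_of_suffix {L L' : List (List Bool × ℕ)} (h : L <:+ L') :
    weight L ≤ weight L' := by
  obtain ⟨M, rfl⟩ := h
  have : weight (M ++ L) = weight M + weight L := by simp [weight]
  linarith [weight_nonneg M]

theorem weight_eq_sum_toFinset {L : List (List Bool × ℕ)} (h : L.Nodup) :
    weight L = ∑ r ∈ L.toFinset, (1 / 2 : ℝ) ^ r.2 := (List.sum_toFinset _ h).symm

/-- The word `p` has length `l + 1` and its dyadic interval lies in the interval of length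
`2 ^ (-l)` starting at the Kraft sum of `L`. -/
def InSlot (L : List (List Bool × ℕ)) (l : ℕ) (p : List Bool) : Prop :=
  p.length = l + 1 ∧
    kraftNum (L.map Prod.snd) * 2 ^ (l + 1) ≤ beVal p * 2 ^ (L.map Prod.snd).sum ∧
    (beVal p + 1) * 2 ^ (L.map Prod.snd).sum ≤
      kraftNum (L.map Prod.snd) * 2 ^ (l + 1) + 2 * 2 ^ (L.map Prod.snd).sum

instance (L : List (List Bool × ℕ)) (l : ℕ) (p : List Bool) : Decidable (InSlot L l p) :=
  inferInstanceAs (Decidable (_ ∧ _ ∧ _))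

/-- The definition clears denominators to be visibly primitive recursive; the real form is the one
used in estimates. -/
theorem inSlot_iff (L : List (List Bool × ℕ)) (l : ℕ) (p : List Bool) :
    InSlot L l p ↔ p.length = l + 1 ∧ weight L ≤ beVal p / 2 ^ p.length ∧
      ((beVal p : ℝ) + 1) / 2 ^ p.length ≤ weight L + (1 / 2) ^ l := by
  have hw : weight L = (kraftNum (L.map Prod.snd) : ℝ) / 2 ^ (L.map Prod.snd).sum := by
    rw [kraftNum_div, weight, List.map_map]; rfl
  unfold InSlot
  refine and_congr_right fun hl => ?_
  rw [hw, hl]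
  set N := kraftNum (L.map Prod.snd)
  set M := (L.map Prod.snd).sum
  refine and_congr ?_ ?_
  · rw [div_le_div_iff₀ (by positivity) (by positivity)]
    exact_mod_cast Iff.rfl
  · have h2 : (N : ℝ) / 2 ^ M + (1 / 2) ^ l = (N * 2 ^ (l + 1) + 2 * 2 ^ M) / (2 ^ M * 2 ^ (l + 1)) := by
      rw [one_div, inv_pow, pow_succ]
      field_simp
    rw [h2, div_le_div_iff₀ (by positivity) (by positivity), ← mul_assoc,
      mul_le_mul_iff_left₀ (by positivity : (0 : ℝ) < 2 ^ (l + 1))]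
    exact_mod_cast Iff.rfl

theorem primrec_inSlot : PrimrecPred fun z : List (List Bool × ℕ) × ℕ × List Bool =>
    InSlot z.1 z.2.1 z.2.2 := by
  have hL : Primrec fun z : List (List Bool × ℕ) × ℕ × List Bool => z.1.map Prod.snd :=
    Primrec.list_map Primrec.fst (Primrec.snd.comp Primrec.snd)
  have hN := primrec_kraftNum.comp hL
  have hS := primrec_two_pow.comp (primrec_list_sum.comp hL)
  have hl : Primrec fun z : List (List Bool × ℕ) × ℕ × List Bool => z.2.1 + 1 :=
    Primrec.succ.comp (Primrec.fst.comp Primrec.snd)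
  have hp : Primrec fun z : List (List Bool × ℕ) × ℕ × List Bool => z.2.2 :=
    Primrec.snd.comp Primrec.snd
  have hv := primrec_beVal.comp hp
  have hNl := Primrec.nat_mul.comp hN (primrec_two_pow.comp hl)
  exact (PrimrecRel.comp Primrec.eq (Primrec.list_length.comp hp) hl).and
    ((PrimrecRel.comp Primrec.nat_le hNl (Primrec.nat_mul.comp hv hS)).and
      (PrimrecRel.comp Primrec.nat_le (Primrec.nat_mul.comp (Primrec.succ.comp hv) hS)
        (Primrec.nat_add.comp hNl (Primrec.nat_mul.comp (Primrec.const 2) hS))))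

theorem beVal_append_div_bounds (p t : List Bool) :
    (beVal p : ℝ) / 2 ^ p.length ≤ beVal (p ++ t) / 2 ^ (p ++ t).length ∧
      ((beVal (p ++ t) : ℝ) + 1) / 2 ^ (p ++ t).length ≤ ((beVal p : ℝ) + 1) / 2 ^ p.length := by
  obtain ⟨h₁, h₂⟩ := beVal_append_bounds p t
  have h₁' : (beVal p : ℝ) * 2 ^ t.length ≤ beVal (p ++ t) := by exact_mod_cast h₁
  have h₂' : (beVal (p ++ t) : ℝ) + 1 ≤ (beVal p + 1) * 2 ^ t.length := by exact_mod_cast h₂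
  rw [List.length_append, pow_add]
  constructor <;> rw [div_le_div_iff₀ (by positivity) (by positivity)]
  · nlinarith [pow_pos (two_pos : (0 : ℝ) < 2) p.length]
  · nlinarith [pow_pos (two_pos : (0 : ℝ) < 2) p.length]

/-- At stage `i` the word `p` is allocated to the new request `r`. -/
def Allocated (e : ℕ → Option (List Bool × ℕ)) (p : List Bool) (i : ℕ) (r : List Bool × ℕ) :
    Prop :=
  e i = some r ∧ r ∉ requests e i ∧ InSlot (requests e i) r.2 p

theorem Allocated.weight_le {e : ℕ → Option (List Bool × ℕ)} {p : List Bool} {i j : ℕ}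
    {r : List Bool × ℕ} (h : Allocated e p i r) (hij : i < j) :
    weight (requests e i) + (1 / 2) ^ r.2 ≤ weight (requests e j) := by
  have h1 : requests e (i + 1) = r :: requests e i := by
    rw [requests_succ, h.1, Option.elim_some, if_neg h.2.1]
  have := weight_le_of_suffix (suffix_requests e hij)
  rw [Nat.succ_eq_add_one, h1, weight_cons] at this
  linarith

/-- The slots of different stages are consecutive intervals that do not overlap, whereas the dyadic
interval of an extension of `p` lies inside that of `p`. -/
theorem Allocated.stage_eq {e : ℕ → Option (List Bool × ℕ)} {p t : List Bool} {i j : ℕ}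
    {r s : List Bool × ℕ} (h : Allocated e p i r) (h' : Allocated e (p ++ t) j s) : i = j := by
  obtain ⟨-, ha, hb⟩ := (inSlot_iff _ _ _).1 h.2.2
  obtain ⟨-, ha', hb'⟩ := (inSlot_iff _ _ _).1 h'.2.2
  obtain ⟨h₁, h₂⟩ := beVal_append_div_bounds p t
  have hlt : ∀ q : List Bool, (beVal q : ℝ) / 2 ^ q.length < ((beVal q : ℝ) + 1) / 2 ^ q.length :=
    fun q => by gcongr; linarith
  rcases lt_trichotomy i j with hij | hij | hij
  · linarith [h.weight_le hij, hlt (p ++ t)]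
  · exact hij
  · linarith [h'.weight_le hij, hlt (p ++ t)]

/-- An interval of length $2^{-l}$ with arbitrary left endpoint contains an aligned dyadic interval
of half that length. The lost bit buys an allocation that needs neither sorting nor a record of the
free intervals. -/
theorem exists_inSlot (L : List (List Bool × ℕ)) (l : ℕ) (h : weight L + (1 / 2) ^ l ≤ 1) :
    ∃ p, InSlot L l p := by
  set z := ⌈weight L * 2 ^ (l + 1)⌉₊ with hz
  have h1 : weight L * 2 ^ (l + 1) ≤ z := Nat.le_ceil _
  have h2 : (z : ℝ) < weight L * 2 ^ (l + 1) + 1 :=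
    Nat.ceil_lt_add_one (mul_nonneg (weight_nonneg L) (by positivity))
  have h3 : (1 / 2 : ℝ) ^ l * 2 ^ (l + 1) = 2 := by
    rw [pow_succ, ← mul_assoc, ← mul_pow]; norm_num
  have h4 : (z : ℝ) + 1 < (weight L + (1 / 2) ^ l) * 2 ^ (l + 1) := by
    rw [add_mul, h3]; linarith
  have h5 : (z : ℝ) < 2 ^ (l + 1) := by
    have : (weight L + (1 / 2) ^ l) * 2 ^ (l + 1) ≤ 1 * 2 ^ (l + 1) := by gcongr
    linarith
  obtain ⟨p, hp, hv⟩ := exists_beVal_eq (l + 1) z (by exact_mod_cast h5)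
  refine ⟨p, (inSlot_iff _ _ _).2 ⟨hp, ?_, ?_⟩⟩
  · rw [hv, hp, le_div_iff₀ (by positivity)]; exact h1
  · rw [hv, hp, div_le_iff₀ (by positivity)]; exact h4.le

/-- Each new request receives a word from the slot starting at the Kraft sum of the earlier ones.
Prefix-freeness holds for every `y`; the Kraft condition serves only to guarantee that the slot fits
into the unit interval. -/
theorem exists_kraftChaitin {e : List Bool → ℕ → Option (List Bool × ℕ)} (he : Primrec₂ e) :
    ∃ V : List Bool → List Bool →. List Bool, IsPrefixComputer V ∧
      ∀ y, (∀ F : Finset (List Bool × ℕ), (∀ r ∈ F, ∃ i, e y i = some r) →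
          ∑ r ∈ F, (1 / 2 : ℝ) ^ r.2 ≤ 1) →
        ∀ i r, e y i = some r → ∃ p : List Bool, p.length = r.2 + 1 ∧ r.1 ∈ V p y := by
  set out : List Bool → List Bool → ℕ → Option (List Bool) := fun p y i =>
    (e y i).bind fun r =>
      if r ∉ requests (e y) i ∧ InSlot (requests (e y) i) r.2 p then some r.1 else none with hout
  have hspec : ∀ p y i x, out p y i = some x ↔ ∃ r, Allocated (e y) p i r ∧ r.1 = x := by
    intro p y i x
    simp only [hout, Option.bind_eq_some_iff, Allocated]
    constructor
    · rintro ⟨r, hr, h⟩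
      split_ifs at h with hc
      exact ⟨r, ⟨hr, hc.1, hc.2⟩, by simpa using h⟩
    · rintro ⟨r, ⟨hr, h1, h2⟩, rfl⟩
      exact ⟨r, hr, if_pos ⟨h1, h2⟩⟩
  refine ⟨fun p y => Nat.rfindOpt (out p y), ⟨?_, ?_⟩, ?_⟩
  · refine Partrec.rfindOpt (f := fun z : List Bool × List Bool => out z.1 z.2)
      (Primrec.to_comp ?_)
    have hi : Primrec fun z : (List Bool × List Bool) × ℕ => z.2 := Primrec.snd
    have hp : Primrec fun z : (List Bool × List Bool) × ℕ => z.1.1 :=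
      Primrec.fst.comp Primrec.fst
    have hy : Primrec fun z : (List Bool × List Bool) × ℕ => z.1.2 :=
      Primrec.snd.comp Primrec.fst
    refine Primrec.option_bind (he.comp hy hi) ?_
    have hr : Primrec fun z : ((List Bool × List Bool) × ℕ) × List Bool × ℕ => z.2 := Primrec.snd
    have hL : Primrec fun z : ((List Bool × List Bool) × ℕ) × List Bool × ℕ =>
        requests (e z.1.1.2) z.1.2 :=
      ((primrec_requests he).comp hy hi).comp Primrec.fst
    refine Primrec.ite (PrimrecPred.and (PrimrecPred.not
      (PrimrecRel.comp (R := fun (a : List Bool × ℕ) (L : List (List Bool × ℕ)) => a ∈ L)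
        primrecRel_mem hr hL)) ?_)
      (Primrec.option_some.comp (Primrec.fst.comp hr)) (Primrec.const none)
    exact primrec_inSlot.comp (hL.pair ((Primrec.snd.comp hr).pair (hp.comp Primrec.fst)))
  · intro y p t h ht h'
    obtain ⟨i, hi⟩ := Nat.rfindOpt_spec (Part.get_mem h)
    obtain ⟨j, hj⟩ := Nat.rfindOpt_spec (Part.get_mem h')
    obtain ⟨r, hr, -⟩ := (hspec _ _ _ _).1 hi
    obtain ⟨s, hs, -⟩ := (hspec _ _ _ _).1 hj
    obtain rfl := hr.stage_eq hs
    obtain rfl : r = s := Option.some_injective _ (hr.1.symm.trans hs.1)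
    have := hr.2.2.1.trans hs.2.2.1.symm
    simp only [List.length_append] at this
    exact ht (List.length_eq_zero_iff.1 (by omega))
  · intro y hF i r hi
    have hex : ∃ i, e y i = some r := ⟨i, hi⟩
    classical
    -- A word is allocated only at the first appearance of a request.
    set j := Nat.find hex with hj
    have hj1 : e y j = some r := Nat.find_spec hex
    have hj2 : r ∉ requests (e y) j := by
      rw [mem_requests_iff]
      rintro ⟨k, hk, h⟩
      exact Nat.find_min hex hk h
    obtain ⟨p, hp⟩ := exists_inSlot (requests (e y) j) r.2 (by
      rw [add_comm, ← weight_cons, weight_eq_sum_toFinset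
        (List.nodup_cons.2 ⟨hj2, requests_nodup _ _⟩)]
      refine hF _ fun s hs => ?_
      rw [List.mem_toFinset, List.mem_cons] at hs
      rcases hs with rfl | hs
      · exact hex
      · obtain ⟨k, -, hk⟩ := (mem_requests_iff _ _ _).1 hs
        exact ⟨k, hk⟩)
    have hall : Allocated (e y) p j r := ⟨hj1, hj2, hp⟩
    refine ⟨p, hp.1, ?_⟩
    have hd : (Nat.rfindOpt (out p y)).Dom :=
      Nat.rfindOpt_dom.2 ⟨j, r.1, (hspec _ _ _ _).2 ⟨r, hall, rfl⟩⟩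
    obtain ⟨k, hk⟩ := Nat.rfindOpt_spec (Part.get_mem hd)
    obtain ⟨s, hs, hs'⟩ := (hspec _ _ _ _).1 hk
    have hjk : j = k := hall.stage_eq (t := []) (by simpa using hs)
    rw [← hjk] at hs
    obtain rfl : r = s := Option.some_injective _ (hall.1.symm.trans hs.1)
    rw [hs']
    exact Part.get_mem hd

/-! ### The coding theorem for lengths and the conditional complexity of a string given its length -/

theorem dedup_eq_foldr {α : Type*} [DecidableEq α] (l : List α) :
    l.dedup = l.foldr (fun a L => if a ∈ L then L else a :: L) [] := by
  induction l with
  | nil => rfl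
  | cons a l ih =>
    rw [List.foldr_cons, ← ih]
    by_cases h : a ∈ l
    · rw [List.dedup_cons_of_mem h, if_pos (List.mem_dedup.2 h)]
    · rw [List.dedup_cons_of_notMem h, if_neg (mt List.mem_dedup.1 h)]

theorem primrec_dedup {α : Type*} [Primcodable α] [DecidableEq α] :
    Primrec fun l : List α => l.dedup := by
  refine (Primrec.list_foldr (h := fun _ (z : α × List α) => if z.1 ∈ z.2 then z.2 else z.1 :: z.2)
    Primrec.id (Primrec.const []) ?_).of_eq fun l => (dedup_eq_foldr l).symm
  have h1 : Primrec fun z : List α × α × List α => z.2.1 := Primrec.fst.comp Primrec.snd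
  have h2 : Primrec fun z : List α × α × List α => z.2.2 := Primrec.snd.comp Primrec.snd
  exact Primrec.ite (PrimrecRel.comp (R := fun (a : α) (L : List α) => a ∈ L) primrecRel_mem h1 h2)
    h2 (Primrec.list_cons.comp h1 h2)

/-- The exponents are distinct, so the sum is part of a geometric series starting at the least
exponent. -/
theorem sum_half_pow_succ_le (G : Finset ℕ) {m : ℝ} (hm : 0 ≤ m)
    (h : ∀ l ∈ G, (1 / 2 : ℝ) ^ l ≤ m) : ∑ l ∈ G, (1 / 2 : ℝ) ^ (l + 1) ≤ m := by
  rcases G.eq_empty_or_nonempty with rfl | hne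
  · simpa using hm
  · have key : ∀ a b : ℕ, a ≤ b →
        ∑ l ∈ Finset.Ico a b, (1 / 2 : ℝ) ^ (l + 1) = (1 / 2) ^ a - (1 / 2) ^ b := by
      intro a b hab
      induction b, hab using Nat.le_induction with
      | base => simp
      | succ b hab ih => rw [Finset.sum_Ico_succ_top hab, ih, pow_succ]; ring
    have hsub : G ⊆ Finset.Ico (G.min' hne) (G.max' hne + 1) := fun l hl =>
      Finset.mem_Ico.2 ⟨G.min'_le l hl, Nat.lt_succ_of_le (G.le_max' l hl)⟩
    calc ∑ l ∈ G, (1 / 2 : ℝ) ^ (l + 1)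
        ≤ ∑ l ∈ Finset.Ico (G.min' hne) (G.max' hne + 1), (1 / 2 : ℝ) ^ (l + 1) :=
          Finset.sum_le_sum_of_subset_of_nonneg hsub fun _ _ _ => by positivity
      _ ≤ (1 / 2) ^ G.min' hne := by
          have hle : G.min' hne ≤ G.max' hne + 1 := (G.min'_le_max' hne).trans (Nat.le_succ _)
          rw [key _ _ hle]
          linarith [show (0 : ℝ) < (1 / 2) ^ (G.max' hne + 1) by positivity]
      _ ≤ m := h _ (G.min'_mem hne)

/-- Group the requests by target. Within a group the previous lemma bounds the sum by the weight of
the programs mapped to that target, and these sets of programs are disjoint for different targets.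
-/
theorem sum_requests_le (F : Finset (List Bool × ℕ)) (Q : Finset (List Bool))
    (f : List Bool → List Bool)
    (h : ∀ r ∈ F, 1 ≤ r.2 ∧
      (1 / 2 : ℝ) ^ (r.2 - 1) ≤ ∑ p ∈ Q with f p = r.1, (1 / 2 : ℝ) ^ p.length) :
    ∑ r ∈ F, (1 / 2 : ℝ) ^ r.2 ≤ ∑ p ∈ Q, (1 / 2 : ℝ) ^ p.length := by
  have h0 : ∀ S : Finset (List Bool), 0 ≤ ∑ p ∈ S, (1 / 2 : ℝ) ^ p.length :=
    fun S => Finset.sum_nonneg fun _ _ => by positivity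
  calc ∑ r ∈ F, (1 / 2 : ℝ) ^ r.2
      = ∑ w ∈ F.image Prod.fst, ∑ r ∈ F with r.1 = w, (1 / 2 : ℝ) ^ r.2 :=
        (Finset.sum_fiberwise_of_maps_to (fun r hr => Finset.mem_image_of_mem _ hr) _).symm
    _ ≤ ∑ w ∈ F.image Prod.fst, ∑ p ∈ Q with f p = w, (1 / 2 : ℝ) ^ p.length := by
        refine Finset.sum_le_sum fun w _ => ?_
        have hinj : Set.InjOn (fun r : List Bool × ℕ => r.2 - 1)
            (F.filter fun r => r.1 = w : Finset (List Bool × ℕ)) := by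
          intro r hr s hs hrs
          simp only [Finset.coe_filter, Set.mem_ofPred_eq] at hr hs hrs
          have := (h r hr.1).1
          have := (h s hs.1).1
          exact Prod.ext (hr.2.trans hs.2.symm) (by omega)
        have := sum_half_pow_succ_le ((F.filter fun r => r.1 = w).image fun r => r.2 - 1)
          (h0 (Q.filter fun p => f p = w)) (by
            intro l hl
            obtain ⟨r, hr, rfl⟩ := Finset.mem_image.1 hl
            obtain ⟨hr', rfl⟩ := Finset.mem_filter.1 hr
            exact (h r hr').2)
        rw [Finset.sum_image hinj] at this
        refine le_trans (le_of_eq (Finset.sum_congr rfl fun r hr => ?_)) this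
        rw [Nat.sub_add_cancel (h r (Finset.mem_filter.1 hr).1).1]
    _ ≤ ∑ p ∈ Q, (1 / 2 : ℝ) ^ p.length := by
        rw [← Finset.sum_biUnion]
        · exact Finset.sum_le_sum_of_subset_of_nonneg
            (Finset.biUnion_subset.2 fun _ _ => Finset.filter_subset _ _)
            fun _ _ _ => by positivity
        · intro v _ w _ hvw
          exact Finset.disjoint_filter.2 fun p _ hp hp' => hvw (hp.symm.trans hp')

/-- Once halting programs of weight $2^{-j}$ are seen to produce strings of length $n$, a word of
length $j+1$ is requested for $n$. The Kraft sum of all requests is then at most that of the halting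
programs of `U`. -/
theorem IsUniversalPrefixComputer.exists_coding (hU : IsUniversalPrefixComputer U) :
    ∃ c : ℕ, ∀ (n : ℕ) (P : Finset (List Bool)), (∀ p ∈ P, ∃ x ∈ U p [], x.length = n) →
      ∀ j : ℕ, (1 / 2 : ℝ) ^ j ≤ ∑ p ∈ P, (1 / 2 : ℝ) ^ p.length →
        ∃ q : List Bool, q.length ≤ j + c ∧ natCode n ∈ U q [] := by
  obtain ⟨g, hg⟩ := exists_isStaging hU.partrec
  -- Duplicates are removed so that no program is weighed twice.
  let cond : ℕ × List (List Bool) × ℕ × ℕ → Prop := fun z =>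
    (∀ p ∈ z.2.1.dedup, (g z.1 p []).map List.length = some z.2.2.1) ∧
      2 ^ (z.2.1.dedup.map List.length).sum ≤
        kraftNum (z.2.1.dedup.map List.length) * 2 ^ z.2.2.2
  have hcond : PrimrecPred cond := by
    have ht : Primrec fun z : ℕ × List (List Bool) × ℕ × ℕ => z.1 := Primrec.fst
    have hn : Primrec fun z : ℕ × List (List Bool) × ℕ × ℕ => z.2.2.1 :=
      Primrec.fst.comp (Primrec.snd.comp Primrec.snd)
    have hj : Primrec fun z : ℕ × List (List Bool) × ℕ × ℕ => z.2.2.2 :=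
      Primrec.snd.comp (Primrec.snd.comp Primrec.snd)
    have hF : Primrec fun z : ℕ × List (List Bool) × ℕ × ℕ => z.2.1.dedup :=
      primrec_dedup.comp (Primrec.fst.comp Primrec.snd)
    have hl : Primrec fun z : ℕ × List (List Bool) × ℕ × ℕ => z.2.1.dedup.map List.length :=
      Primrec.list_map hF (Primrec.list_length.comp Primrec.snd)
    have hR : PrimrecRel fun (p : List Bool) (b : ℕ × ℕ) =>
        (g b.1 p []).map List.length = some b.2 := by
      refine PrimrecRel.comp Primrec.eq (Primrec.option_map ?_
        (Primrec.list_length.comp Primrec.snd))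
        (Primrec.option_some.comp (Primrec.snd.comp Primrec.snd))
      exact hg.comp_primrec (Primrec.fst.comp Primrec.snd) Primrec.fst (Primrec.const [])
    refine PrimrecPred.and (PrimrecRel.comp (PrimrecRel.forall_mem_list hR) hF (ht.pair hn)) ?_
    exact PrimrecRel.comp Primrec.nat_le (primrec_two_pow.comp (primrec_list_sum.comp hl))
      (Primrec.nat_mul.comp (primrec_kraftNum.comp hl) (primrec_two_pow.comp hj))
  have hcond_iff : ∀ t F n j, cond (t, F, n, j) ↔
      (∀ p ∈ F.toFinset, ∃ x, g t p [] = some x ∧ x.length = n) ∧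
        (1 / 2 : ℝ) ^ j ≤ ∑ p ∈ F.toFinset, (1 / 2 : ℝ) ^ p.length := by
    intro t F n j
    refine and_congr (by simp) ?_
    have h1 : ∑ p ∈ F.toFinset, (1 / 2 : ℝ) ^ p.length =
        (kraftNum (F.dedup.map List.length) : ℝ) / 2 ^ (F.dedup.map List.length).sum := by
      have h0 : F.toFinset = F.dedup.toFinset := by ext; simp
      rw [kraftNum_div, h0, List.sum_toFinset _ (List.nodup_dedup F),
        List.map_map]
      rfl
    rw [h1, one_div, inv_pow, ← one_div, div_le_div_iff₀ (by positivity) (by positivity), one_mul]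
    exact_mod_cast Iff.rfl
  classical
  let e : List Bool → ℕ → Option (List Bool × ℕ) := fun _ i =>
    (Encodable.decode (α := ℕ × List (List Bool) × ℕ × ℕ) i).bind fun z =>
      if cond z then some (natCode z.2.2.1, z.2.2.2 + 1) else none
  have he : Primrec₂ e := by
    refine Primrec.option_bind (Primrec.decode.comp Primrec.snd) ?_
    refine Primrec.ite (hcond.comp Primrec.snd) (Primrec.option_some.comp ?_) (Primrec.const none)
    have h : Primrec fun z : (List Bool × ℕ) × ℕ × List (List Bool) × ℕ × ℕ => z.2.2.2 :=
      Primrec.snd.comp (Primrec.snd.comp Primrec.snd)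
    exact (primrec_natCode.comp (Primrec.fst.comp h)).pair
      (Primrec.succ.comp (Primrec.snd.comp h))
  obtain ⟨V, hV, hVe⟩ := exists_kraftChaitin he
  obtain ⟨c, hc⟩ := hU.universal V hV
  refine ⟨c + 2, fun n P hP j hj => ?_⟩
  have hsum : ∀ F : Finset (List Bool × ℕ), (∀ r ∈ F, ∃ i, e [] i = some r) →
      ∑ r ∈ F, (1 / 2 : ℝ) ^ r.2 ≤ 1 := by
    intro F hF
    -- Sends a program to the code of the length of its output, the target that its weight supports.
    let f : List Bool → List Bool := fun p =>
      if h : (U p []).Dom then natCode ((U p []).get h).length else []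
    have hF' : ∀ r ∈ F, ∃ S : Finset (List Bool), (∀ p ∈ S, (U p []).Dom ∧ f p = r.1) ∧
        1 ≤ r.2 ∧ (1 / 2 : ℝ) ^ (r.2 - 1) ≤ ∑ p ∈ S, (1 / 2 : ℝ) ^ p.length := by
      intro r hr
      obtain ⟨i, hi⟩ := hF r hr
      obtain ⟨⟨t, L, n, j⟩, -, hz⟩ := Option.bind_eq_some_iff.1 hi
      split_ifs at hz with hcz
      obtain rfl := Option.some_injective _ hz
      rw [hcond_iff] at hcz
      refine ⟨L.toFinset, fun p hp => ?_, by simp, by simpa using hcz.2⟩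
      obtain ⟨x, hx, hxn⟩ := hcz.1 p hp
      have hm := hg.mem_of_eq hx
      refine ⟨hm.1, ?_⟩
      simp only [f, dif_pos hm.1, Part.get_eq_of_mem hm, hxn]
    choose! S hS using hF'
    refine (sum_requests_le F (F.biUnion S) f fun r hr => ⟨(hS r hr).2.1, ?_⟩).trans
      (hU.kraft [] _ fun p hp => ?_)
    · refine (hS r hr).2.2.trans (Finset.sum_le_sum_of_subset_of_nonneg (fun p hp => ?_)
        fun _ _ _ => by positivity)
      exact Finset.mem_filter.2 ⟨Finset.mem_biUnion.2 ⟨r, hr, hp⟩, ((hS r hr).1 p hp).2⟩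
    · obtain ⟨r, hr, hp⟩ := Finset.mem_biUnion.1 hp
      exact ((hS r hr).1 p hp).1
  have hstage : ∃ t, ∀ p ∈ P, ∃ x, g t p [] = some x ∧ x.length = n := by
    have : ∀ p ∈ P, ∃ t x, g t p [] = some x ∧ x.length = n := fun p hp => by
      obtain ⟨x, hx, hn⟩ := hP p hp
      obtain ⟨t, ht⟩ := (hg.mem_iff _ _ _).1 hx
      exact ⟨t, x, ht, hn⟩
    choose! t x h using this
    exact ⟨P.sup t, fun p hp => ⟨x p, hg.mono (Finset.le_sup hp) (h p hp).1, (h p hp).2⟩⟩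
  obtain ⟨t, ht⟩ := hstage
  obtain ⟨p, hp, hpV⟩ := hVe [] hsum (Encodable.encode (t, P.toList, n, j)) (natCode n, j + 1) (by
    have : cond (t, P.toList, n, j) := by
      rw [hcond_iff, Finset.toList_toFinset]; exact ⟨ht, hj⟩
    simp only [e, Encodable.encodek, Option.bind_some, if_pos this])
  obtain ⟨q, hq, hqU⟩ := hc p
  exact ⟨q, by rw [hp] at hq; dsimp only at hq; omega, hqU _ _ hpV⟩

/-- Apply the coding theorem with the least $j$ such that $2^{-j}$ does not exceed the weight; this
$j$ is sharp up to a factor of two. -/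
theorem IsUniversalPrefixComputer.exists_sum_le (hU : IsUniversalPrefixComputer U) :
    ∃ c : ℕ, ∀ (n : ℕ) (P : Finset (List Bool)), (∀ p ∈ P, ∃ x ∈ U p [], x.length = n) →
      ∀ s, IsStar U (natCode n) s →
        ∑ p ∈ P, (1 / 2 : ℝ) ^ p.length ≤ 2 ^ c * (1 / 2) ^ s.length := by
  obtain ⟨c, hc⟩ := hU.exists_coding
  refine ⟨c + 1, fun n P hP s hs => ?_⟩
  set S := ∑ p ∈ P, (1 / 2 : ℝ) ^ p.length with hS
  rcases le_or_gt S 0 with h0 | h0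
  · exact h0.trans (by positivity)
  have h1 : S ≤ 1 := hU.kraft [] P fun p hp => by obtain ⟨x, hx, -⟩ := hP p hp; exact hx.1
  have hex : ∃ j : ℕ, (1 / 2 : ℝ) ^ j ≤ S :=
    (exists_pow_lt_of_lt_one h0 (by norm_num)).imp fun _ h => h.le
  classical
  obtain ⟨j, hj, hmin⟩ : ∃ j : ℕ, (1 / 2 : ℝ) ^ j ≤ S ∧ S ≤ 2 * (1 / 2) ^ j := by
    refine ⟨Nat.find hex, Nat.find_spec hex, ?_⟩
    rcases h : Nat.find hex with _ | k
    · norm_num; linarith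
    · have := Nat.find_min hex (m := k) (by omega)
      rw [pow_succ]; linarith
  obtain ⟨q, hq, hqU⟩ := hc n P hP j hj
  have hle : s.length ≤ j + c := by
    have : (s.length : ℕ∞) ≤ q.length := hs.length_eq.le.trans
      (minLength_le (S := {p | natCode n ∈ U p []}) hqU)
    exact (by exact_mod_cast this : s.length ≤ q.length).trans hq
  have h2 : (1 / 2 : ℝ) ^ (j + c) ≤ (1 / 2) ^ s.length :=
    pow_le_pow_of_le_one (by norm_num) (by norm_num) hle
  have h3 : (2 : ℝ) ^ c * (1 / 2) ^ c = 1 := by rw [← mul_pow]; norm_num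
  have h4 : (0 : ℝ) < 2 ^ c := by positivity
  calc S ≤ 2 * (1 / 2) ^ j := hmin
    _ = 2 ^ (c + 1) * (1 / 2) ^ (j + c) := by
        rw [pow_add, pow_succ]; linear_combination (-2 * (1 / 2 : ℝ) ^ j) * h3
    _ ≤ _ := by gcongr

/-- A program for `x` can be shortened by `K(n)` bits, `n` the length of `x`, when a minimal
program of `n` is given. -/
theorem IsUniversalPrefixComputer.exists_conditional (hU : IsUniversalPrefixComputer U) :
    ∃ c : ℕ, ∀ x s p : List Bool, IsStar U (natCode x.length) s → x ∈ U p [] →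
      ∃ q : List Bool, q.length + s.length ≤ p.length + c ∧ x ∈ U q s := by
  obtain ⟨g, hg⟩ := exists_isStaging hU.partrec
  obtain ⟨c, hc⟩ := hU.exists_sum_le
  -- The input $y = n^*$ supplies both $n$ (by running it) and $K(n)$ (as its length); this is where
  -- conditioning on $n^*$ rather than on $n$ matters.
  let e : List Bool → ℕ → Option (List Bool × ℕ) := fun y i =>
    (g i.unpair.1 y []).bind fun w => (Encodable.decode (α := List Bool) i.unpair.2).bind fun p =>
      (g i.unpair.1 p []).bind fun x =>
        if natCode x.length = w then some (x, p.length + c - y.length) else none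
  have he : Primrec₂ e := by
    have hi : Primrec fun z : List Bool × ℕ => z.2.unpair := Primrec.unpair.comp Primrec.snd
    refine Primrec.option_bind
      (hg.comp_primrec (Primrec.fst.comp hi) Primrec.fst (Primrec.const [])) ?_
    refine Primrec.option_bind (Primrec.decode.comp (Primrec.snd.comp (hi.comp Primrec.fst))) ?_
    refine Primrec.option_bind (hg.comp_primrec
      (Primrec.fst.comp (hi.comp (Primrec.fst.comp Primrec.fst))) Primrec.snd
      (Primrec.const [])) ?_
    refine Primrec.ite (PrimrecRel.comp Primrec.eq
      (primrec_natCode.comp (Primrec.list_length.comp Primrec.snd))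
      (Primrec.snd.comp (Primrec.fst.comp Primrec.fst))) (Primrec.option_some.comp ?_)
      (Primrec.const none)
    refine Primrec.pair Primrec.snd (Primrec.nat_sub.comp (Primrec.nat_add.comp
      (Primrec.list_length.comp (Primrec.snd.comp Primrec.fst)) (Primrec.const c)) ?_)
    exact Primrec.list_length.comp
      (Primrec.fst.comp (Primrec.fst.comp (Primrec.fst.comp Primrec.fst)))
  obtain ⟨V, hV, hVe⟩ := exists_kraftChaitin he
  obtain ⟨d, hd⟩ := hU.universal V hV
  refine ⟨c + 1 + d, fun x s p hs hx => ?_⟩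
  -- The weight bound for a single program shows that the truncated subtraction in `e` never
  -- truncates when `y = s`.
  have hlen : ∀ p, (∃ z ∈ U p [], z.length = x.length) → s.length ≤ p.length + c := by
    intro p hp
    have := hc x.length {p} (by simpa using hp) s hs
    rw [Finset.sum_singleton, one_div, inv_pow, inv_pow, ← div_eq_mul_inv,
      inv_le_comm₀ (by positivity) (by positivity), inv_div,
      div_le_iff₀ (by positivity), ← pow_add] at this
    exact (pow_le_pow_iff_right₀ (by norm_num : (1 : ℝ) < 2)).1 this
  have hsum : ∀ F : Finset (List Bool × ℕ), (∀ r ∈ F, ∃ i, e s i = some r) →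
      ∑ r ∈ F, (1 / 2 : ℝ) ^ r.2 ≤ 1 := by
    intro F hF
    have hF' : ∀ r ∈ F, ∃ p, r.1 ∈ U p [] ∧ r.1.length = x.length ∧
        r.2 = p.length + c - s.length := by
      intro r hr
      obtain ⟨i, hi⟩ := hF r hr
      obtain ⟨w, hw, hi⟩ := Option.bind_eq_some_iff.1 hi
      obtain ⟨p, -, hi⟩ := Option.bind_eq_some_iff.1 hi
      obtain ⟨z, hz, hi⟩ := Option.bind_eq_some_iff.1 hi
      split_ifs at hi with hzw
      obtain rfl := Option.some_injective _ hi
      refine ⟨p, hg.mem_of_eq hz, natCode_injective ?_, rfl⟩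
      rw [hzw]; exact Part.mem_unique (hg.mem_of_eq hw) hs.1
    choose! P hP using hF'
    -- A program determines its output and its length, so distinct requests stem from distinct
    -- programs.
    have hinj : Set.InjOn P F := by
      intro r hr r' hr' h
      refine Prod.ext (Part.mem_unique (hP r hr).1 (h ▸ (hP r' hr').1)) ?_
      rw [(hP r hr).2.2, (hP r' hr').2.2, h]
    have h := hc x.length (F.image P) (by
      intro p hp
      obtain ⟨r, hr, rfl⟩ := Finset.mem_image.1 hp
      exact ⟨r.1, (hP r hr).1, (hP r hr).2.1⟩) s hs
    rw [Finset.sum_image hinj] at h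
    have h2 : ∀ k : ℕ, (1 / 2 : ℝ) ^ k * 2 ^ k = 1 := fun k => by rw [← mul_pow]; norm_num
    calc ∑ r ∈ F, (1 / 2 : ℝ) ^ r.2
        = (∑ r ∈ F, (1 / 2 : ℝ) ^ (P r).length) * ((1 / 2) ^ c * 2 ^ s.length) := by
          rw [Finset.sum_mul]
          refine Finset.sum_congr rfl fun r hr => ?_
          have hle := hlen (P r) ⟨r.1, (hP r hr).1, (hP r hr).2.1⟩
          rw [(hP r hr).2.2, ← mul_assoc, ← pow_add]
          conv_rhs => rw [← Nat.sub_add_cancel hle, pow_add, mul_assoc, h2, mul_one]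
      _ ≤ (2 ^ c * (1 / 2) ^ s.length) * ((1 / 2) ^ c * 2 ^ s.length) := by gcongr
      _ = ((1 / 2) ^ c * 2 ^ c) * ((1 / 2) ^ s.length * 2 ^ s.length) := by ring
      _ = 1 := by rw [h2, h2, one_mul]
  obtain ⟨t₁, h₁⟩ := (hg.mem_iff _ _ _).1 hs.1
  obtain ⟨t₂, h₂⟩ := (hg.mem_iff _ _ _).1 hx
  obtain ⟨q, hq, hqV⟩ := hVe s hsum (Nat.pair (max t₁ t₂) (Encodable.encode p))
    (x, p.length + c - s.length) (by
      simp only [e, Nat.unpair_pair, Encodable.encodek, Option.bind_some,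
        hg.mono (le_max_left t₁ t₂) h₁, hg.mono (le_max_right t₁ t₂) h₂, if_true])
  obtain ⟨q', hq', hqU⟩ := hd q
  have := hlen p ⟨x, hx, rfl⟩
  exact ⟨q', by dsimp only at hq; omega, hqU _ _ hqV⟩

/-! ### Uniform ensembles -/

theorem primrec_pow : Primrec₂ fun a b : ℕ => a ^ b := Primrec₂.unpaired'.1 Nat.Primrec.pow

/-- The answer to a query about the uniform distribution on the distinct entries of `L`. -/
def uniformAnswer (L : List (List Bool)) (q : Option (List Bool) × ℕ) : ℕ :=
  q.1.elim ((natCode (L.dedup.length ^ 2 ^ q.2)).length - 1)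
    fun s => if s ∈ L then 2 ^ q.2 / L.dedup.length else 0

theorem primrec_uniformAnswer : Primrec₂ uniformAnswer := by
  have hL : Primrec fun z : List (List Bool) × Option (List Bool) × ℕ => z.1.dedup.length :=
    Primrec.list_length.comp (primrec_dedup.comp Primrec.fst)
  have hj : Primrec fun z : List (List Bool) × Option (List Bool) × ℕ => 2 ^ z.2.2 :=
    primrec_two_pow.comp (Primrec.snd.comp Primrec.snd)
  refine (Primrec.option_casesOn
    (o := fun z : List (List Bool) × Option (List Bool) × ℕ => z.2.1)
    (f := fun z => (natCode (z.1.dedup.length ^ 2 ^ z.2.2)).length - 1)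
    (g := fun z s => if s ∈ z.1 then 2 ^ z.2.2 / z.1.dedup.length else 0)
    (Primrec.fst.comp Primrec.snd) ?_ ?_).of_eq ?_
  · exact Primrec.pred.comp (Primrec.list_length.comp
      (primrec_natCode.comp (primrec_pow.comp hL hj)))
  · exact Primrec.ite (PrimrecRel.comp (R := fun (a : List Bool) (L : List (List Bool)) => a ∈ L)
      primrecRel_mem Primrec.snd (Primrec.fst.comp Primrec.fst))
      (Primrec.nat_div.comp (hj.comp Primrec.fst) (hL.comp Primrec.fst)) (Primrec.const 0)
  · rintro ⟨L, _ | s, j⟩ <;> rfl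

theorem abs_inv_sub_div_le (N j : ℕ) (hN : 0 < N) :
    |((N : ℝ)⁻¹) - ((2 ^ j / N : ℕ) : ℝ) / 2 ^ j| ≤ 1 / 2 ^ j := by
  have h1 : ((2 ^ j / N : ℕ) : ℝ) * N ≤ 2 ^ j := by exact_mod_cast Nat.div_mul_le_self (2 ^ j) N
  have h2 : (2 : ℝ) ^ j < (((2 ^ j / N : ℕ) : ℝ) + 1) * N := by
    exact_mod_cast Nat.lt_mul_of_div_lt (Nat.lt_succ_self (2 ^ j / N)) hN
  have hN' : (0 : ℝ) < N := by exact_mod_cast hN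
  have h3 : (0 : ℝ) < 2 ^ j := by positivity
  have h4 : (N : ℝ)⁻¹ = (2 ^ j / N) / 2 ^ j := by field_simp
  rw [abs_le, h4, ← sub_div, ← neg_div, div_le_div_iff_of_pos_right h3,
    div_le_div_iff_of_pos_right h3]
  have h5 := (le_div_iff₀ hN').2 h1
  have h6 := (div_le_iff₀ hN').2 h2.le
  constructor <;> linarith

/-- The bit length of $M > 0$ minus one is $\lfloor \log M \rfloor$; for $M = N^{2^j}$, division by
$2^j$ gives $\log N$ to accuracy $2^{-j}$ by integer arithmetic alone. -/
theorem abs_logb_sub_length_natCode_le (N j : ℕ) (hN : 0 < N) :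
    |Real.logb 2 N - (((natCode (N ^ 2 ^ j)).length - 1 : ℕ) : ℝ) / 2 ^ j| ≤ 1 / 2 ^ j := by
  set v := (natCode (N ^ 2 ^ j)).length - 1 with hv
  have hpos : 0 < N ^ 2 ^ j := by positivity
  have hsize : (natCode (N ^ 2 ^ j)).length = v + 1 := by
    have : 0 < (natCode (N ^ 2 ^ j)).length := by
      rw [natCode, Nat.size_eq_bits_len]; exact Nat.size_pos.2 hpos
    omega
  rw [natCode, Nat.size_eq_bits_len] at hsize
  have h1 : (2 : ℝ) ^ v ≤ (N : ℝ) ^ 2 ^ j := by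
    exact_mod_cast Nat.lt_size.1 (by omega : v < Nat.size (N ^ 2 ^ j))
  have h2 : (N : ℝ) ^ 2 ^ j < (2 : ℝ) ^ (v + 1) := by
    exact_mod_cast Nat.size_le.1 hsize.le
  have hN' : (0 : ℝ) < N := by exact_mod_cast hN
  have h3 : (0 : ℝ) < 2 ^ j := by positivity
  have h4 : (v : ℝ) ≤ Real.logb 2 N * 2 ^ j := by
    have := Real.logb_le_logb_of_le (b := 2) (by norm_num) (by positivity) h1
    rw [Real.logb_pow, Real.logb_pow, Real.logb_self_eq_one (by norm_num)] at this
    push_cast at this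
    linarith
  have h5 : Real.logb 2 N * 2 ^ j ≤ v + 1 := by
    have := Real.logb_le_logb_of_le (b := 2) (by norm_num) (by positivity) h2.le
    rw [Real.logb_pow, Real.logb_pow, Real.logb_self_eq_one (by norm_num)] at this
    push_cast at this
    linarith
  rw [abs_le]
  have h6 : Real.logb 2 N = Real.logb 2 N * 2 ^ j / 2 ^ j := by field_simp
  rw [h6, ← sub_div, ← neg_div, div_le_div_iff_of_pos_right h3, div_le_div_iff_of_pos_right h3]
  constructor <;> linarith

theorem entropyTerm_uniformOfFinset (A : Finset (List Bool)) (hA : A.Nonempty) (s : List Bool) :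
    entropyTerm (PMF.uniformOfFinset A hA) s =
      if s ∈ A then -((A.card : ℝ)⁻¹ * Real.logb 2 A.card) else 0 := by
  unfold entropyTerm
  rw [PMF.uniformOfFinset_apply]
  split_ifs
  · rw [ENNReal.toReal_inv, ENNReal.toReal_natCast, Real.logb_inv]; ring
  · simp

theorem summable_entropyTerm_uniformOfFinset (A : Finset (List Bool)) (hA : A.Nonempty) :
    Summable (entropyTerm (PMF.uniformOfFinset A hA)) :=
  summable_of_ne_finset_zero (s := A) fun s hs => by
    rw [entropyTerm_uniformOfFinset, if_neg hs]

theorem entropy_uniformOfFinset (A : Finset (List Bool)) (hA : A.Nonempty) :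
    entropy (PMF.uniformOfFinset A hA) = Real.logb 2 A.card := by
  have hc : (A.card : ℝ) ≠ 0 := by exact_mod_cast hA.card_pos.ne'
  unfold entropy
  rw [tsum_eq_sum (s := A) fun s hs => by rw [entropyTerm_uniformOfFinset, if_neg hs],
    Finset.sum_congr rfl fun s hs => by rw [entropyTerm_uniformOfFinset, if_pos hs],
    Finset.sum_const, nsmul_eq_mul]
  field_simp

theorem IsUniversalPrefixComputer.exists_uniform (hU : IsUniversalPrefixComputer U) :
    ∃ c : ℕ, ∀ (p : List Bool) (A : Finset (List Bool)) (hA : A.Nonempty), Lists U p [] A →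
      ∃ q : List Bool, q.length ≤ p.length + c ∧
        ComputesEnsemble U q (PMF.uniformOfFinset A hA) := by
  obtain ⟨c, hc⟩ := hU.exists_post (fun w y => natCode (uniformAnswer
    ((Encodable.decode (α := List (List Bool)) (natVal w)).getD [])
    ((Encodable.decode (α := Option (List Bool) × ℕ) (natVal y)).getD (none, 0)))) (by
      refine primrec_natCode.comp (primrec_uniformAnswer.comp ?_ ?_)
      · exact Primrec.option_getD.comp
          (Primrec.decode.comp (primrec_natVal.comp Primrec.fst)) (Primrec.const [])
      · exact Primrec.option_getD.comp
          (Primrec.decode.comp (primrec_natVal.comp Primrec.snd)) (Primrec.const (none, 0)))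
  refine ⟨c, fun p A hA ⟨l, hl, hp⟩ => ?_⟩
  obtain ⟨q, hq, h⟩ := hc p
  have hcard : l.dedup.length = A.card := by rw [← hl, List.card_toFinset]
  have hans : ∀ k, natCode (uniformAnswer l k) ∈ U q (queryCode k) := by
    intro k
    have := h _ hp (queryCode k)
    rwa [listCode, queryCode, natVal_natCode, natVal_natCode, Encodable.encodek,
      Encodable.encodek] at this
  refine ⟨q, hq, fun s j => ⟨_, hans _, ?_⟩, fun j => ⟨_, hans _, ?_⟩⟩
  · rw [PMF.uniformOfFinset_apply]
    simp only [uniformAnswer, Option.elim_some, hcard]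
    have hm : s ∈ l ↔ s ∈ A := by rw [← hl, List.mem_toFinset]
    by_cases hs : s ∈ A
    · rw [if_pos hs, if_pos (hm.2 hs), ENNReal.toReal_inv, ENNReal.toReal_natCast]
      exact abs_inv_sub_div_le _ _ hA.card_pos
    · rw [if_neg hs, if_neg (mt hm.1 hs)]
      simp
  · rw [entropy_uniformOfFinset]
    simp only [uniformAnswer, Option.elim_none, hcard]
    exact abs_logb_sub_length_natCode_le _ _ hA.card_pos

/-! ### Sets of strings of large probability -/

/-- The list of all strings of length `n`. -/
def strings (n : ℕ) : List (List Bool) :=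
  n.rec [[]] fun _ L => L.map (List.cons false) ++ L.map (List.cons true)

theorem mem_strings_iff (n : ℕ) (s : List Bool) : s ∈ strings n ↔ s.length = n := by
  induction n generalizing s with
  | zero => simp [strings]
  | succ n ih =>
    have : strings (n + 1) = (strings n).map (List.cons false) ++ (strings n).map (List.cons true) :=
      rfl
    rw [this, List.mem_append, List.mem_map, List.mem_map]
    cases s with
    | nil => simp
    | cons b s => cases b <;> simp [ih]

theorem primrec_strings : Primrec strings := by
  refine Primrec.nat_rec₁ (f := fun _ (L : List (List Bool)) =>
    L.map (List.cons false) ++ L.map (List.cons true)) _ ?_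
  exact Primrec.list_append.comp
    (Primrec.list_map Primrec.snd (Primrec.list_cons.comp (Primrec.const false) Primrec.snd))
    (Primrec.list_map Primrec.snd (Primrec.list_cons.comp (Primrec.const true) Primrec.snd))

/-- A number exceeding `H (1 + δ)` by at most a constant, computed from the approximations
`m / 2 ^ (d₀ + 1)` of `H` and `d₀`, `d / 2 ^ (m + 1)` of `δ`. -/
def entropyBound (d₀ m d : ℕ) : ℕ :=
  (m + 1) * (2 ^ (m + 1) + (d + 1)) / 2 ^ (d₀ + 1 + (m + 1)) + 1

theorem primrec_entropyBound : Primrec fun z : ℕ × ℕ × ℕ => entropyBound z.1 z.2.1 z.2.2 := by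
  have h0 : Primrec fun z : ℕ × ℕ × ℕ => z.1 + 1 := Primrec.succ.comp Primrec.fst
  have hm : Primrec fun z : ℕ × ℕ × ℕ => z.2.1 + 1 :=
    Primrec.succ.comp (Primrec.fst.comp Primrec.snd)
  have hd : Primrec fun z : ℕ × ℕ × ℕ => z.2.2 + 1 :=
    Primrec.succ.comp (Primrec.snd.comp Primrec.snd)
  exact Primrec.succ.comp (Primrec.nat_div.comp
    (Primrec.nat_mul.comp hm (Primrec.nat_add.comp (primrec_two_pow.comp hm) hd))
    (primrec_two_pow.comp (Primrec.nat_add.comp h0 hm)))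

/-- Overestimating `H` costs at most 2, since its accuracy was chosen with $2^{d_0+1} \ge 1+\delta$.
Overestimating `δ` costs at most 2, since its accuracy was chosen with $2^{m+1}$ at least the
estimate of `H`. Rounding costs at most 1. -/
theorem entropyBound_spec {H δ : ℝ} {d₀ m d : ℕ} (hδ : 0 ≤ δ)
    (h0 : |δ - d₀ / 2 ^ 0| ≤ 1 / 2 ^ 0) (hm : |H - m / 2 ^ (d₀ + 1)| ≤ 1 / 2 ^ (d₀ + 1))
    (hd : |δ - d / 2 ^ (m + 1)| ≤ 1 / 2 ^ (m + 1)) :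
    H * (1 + δ) ≤ entropyBound d₀ m d ∧ (entropyBound d₀ m d : ℝ) ≤ H * (1 + δ) + 5 := by
  have hJ : ((d₀ : ℝ) + 2) ≤ 2 ^ (d₀ + 1) := by
    exact_mod_cast (Nat.lt_two_pow_self (n := d₀ + 1) : d₀ + 1 < 2 ^ (d₀ + 1))
  have hI : ((m : ℝ) + 1) ≤ 2 ^ (m + 1) := by
    exact_mod_cast (Nat.lt_two_pow_self (n := m + 1)).le
  set N := (m + 1) * (2 ^ (m + 1) + (d + 1)) with hN
  set Q := 2 ^ (d₀ + 1 + (m + 1)) with hQ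
  have hQ0 : 0 < Q := by positivity
  have hT1 : (N : ℝ) / Q ≤ entropyBound d₀ m d := by
    rw [div_le_iff₀ (by exact_mod_cast hQ0)]
    exact_mod_cast (Nat.lt_mul_of_div_lt (Nat.lt_succ_self (N / Q)) hQ0).le
  have hT2 : (entropyBound d₀ m d : ℝ) ≤ N / Q + 1 := by
    have : ((N / Q : ℕ) : ℝ) ≤ N / Q := Nat.cast_div_le
    have e : (entropyBound d₀ m d : ℝ) = ((N / Q : ℕ) : ℝ) + 1 := by
      rw [entropyBound]; push_cast; rfl
    linarith
  set J : ℝ := 2 ^ (d₀ + 1) with hJd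
  set I : ℝ := 2 ^ (m + 1) with hId
  have hJ0 : 0 < J := by positivity
  have hI0 : 0 < I := by positivity
  have hX : (N : ℝ) / Q = (m + 1) / J * (1 + (d + 1) / I) := by
    rw [hN, hQ]
    push_cast
    rw [pow_add 2 (d₀ + 1), ← hJd, ← hId]
    field_simp
  rw [hX] at hT1 hT2
  rw [abs_le] at h0 hm hd
  simp only [pow_zero, div_one] at h0
  have a1 : ((m : ℝ) + 1) / J = m / J + 1 / J := add_div _ _ _
  have a2 : ((d : ℝ) + 1) / I = d / I + 1 / I := add_div _ _ _
  set u := ((m : ℝ) + 1) / J with hu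
  set v := ((d : ℝ) + 1) / I with hv
  have u0 : 0 ≤ u := by positivity
  have v0 : 0 ≤ v := by positivity
  have b1 : H ≤ u := by linarith
  have b2 : u ≤ H + 2 * (1 / J) := by linarith
  have b3 : δ ≤ v := by linarith
  have b4 : v ≤ δ + 2 * (1 / I) := by linarith
  have c1 : u * (1 / I) ≤ 1 := by
    rw [mul_one_div, div_le_one hI0]
    refine le_trans (div_le_self (by positivity) ?_) hI
    linarith
  have c2 : (1 / J) * (1 + δ) ≤ 1 := by
    rw [one_div_mul_eq_div, div_le_one hJ0]; linarith
  constructor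
  · refine le_trans ?_ hT1
    calc H * (1 + δ) ≤ u * (1 + δ) := by gcongr
      _ ≤ u * (1 + v) := by gcongr
  · refine hT2.trans ?_
    calc u * (1 + v) + 1 ≤ u * (1 + (δ + 2 * (1 / I))) + 1 := by gcongr
      _ = u * (1 + δ) + 2 * (u * (1 / I)) + 1 := by ring
      _ ≤ (H + 2 * (1 / J)) * (1 + δ) + 2 * 1 + 1 := by gcongr
      _ = H * (1 + δ) + 2 * (1 / J * (1 + δ)) + 3 := by ring
      _ ≤ H * (1 + δ) + 2 * 1 + 3 := by gcongr
      _ = _ := by ring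

theorem entropy_nonneg (E : PMF (List Bool)) : 0 ≤ entropy E := by
  refine neg_nonneg.2 (tsum_nonpos fun s => ?_)
  refine mul_nonpos_of_nonneg_of_nonpos ENNReal.toReal_nonneg ?_
  refine Real.logb_nonpos (by norm_num) ENNReal.toReal_nonneg ?_
  exact ENNReal.toReal_le_of_le_ofReal zero_le_one (by simpa using E.coe_le_one s)

theorem card_le_of_le_apply (E : PMF (List Bool)) (A : Finset (List Bool)) {b : ℝ} (hb : 0 < b)
    (h : ∀ a ∈ A, b⁻¹ ≤ (E a).toReal) : (A.card : ℝ) ≤ b := by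
  have h1 : ∑ a ∈ A, (E a).toReal ≤ 1 := by
    rw [← ENNReal.toReal_sum fun a _ => E.apply_ne_top a]
    refine ENNReal.toReal_le_of_le_ofReal zero_le_one ?_
    rw [ENNReal.ofReal_one, ← E.tsum_coe]
    exact ENNReal.sum_le_tsum A
  have h2 : (A.card : ℝ) * b⁻¹ ≤ 1 := by
    rw [← nsmul_eq_mul]
    exact (Finset.card_nsmul_le_sum _ _ _ h).trans h1
  rwa [← div_eq_mul_inv, div_le_one hb] at h2

section reply

variable (g : ℕ → List Bool → List Bool → Option (List Bool))

/-- The number computed by program `p` on input `q` within `t` stages (`0` if there is none). -/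
def reply (t : ℕ) (p q : List Bool) : ℕ := ((g t p q).map natVal).getD 0

variable {g}

theorem IsStaging.primrec_reply (hg : IsStaging U g) {α : Type*} [Primcodable α] {t : α → ℕ}
    {p q : α → List Bool} (ht : Primrec t) (hp : Primrec p) (hq : Primrec q) :
    Primrec fun a => reply g (t a) (p a) (q a) :=
  Primrec.option_getD.comp
    (Primrec.option_map (hg.comp_primrec ht hp hq) (primrec_natVal.comp Primrec.snd))
    (Primrec.const 0)

theorem reply_eq {t : ℕ} {p q : List Bool} {m : ℕ} (h : g t p q = some (natCode m)) :
    reply g t p q = m := by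
  simp [reply, h, natVal_natCode]

theorem IsStaging.reply_approx (hg : IsStaging U g) {t : ℕ} {p q : List Bool} {r : ℝ} {k : ℕ}
    (h : Approximates U p q r k) (ht : (g t p q).isSome) :
    |r - (reply g t p q : ℝ) / 2 ^ k| ≤ 1 / 2 ^ k := by
  obtain ⟨m, hm, hr⟩ := h
  obtain ⟨x, hx⟩ := Option.isSome_iff_exists.1 ht
  obtain rfl := Part.mem_unique hm (hg.mem_of_eq hx)
  rwa [reply_eq hx]

theorem IsStaging.eventually_eq (hg : IsStaging U g) {p q x : List Bool} (h : x ∈ U p q) :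
    ∀ᶠ t in Filter.atTop, g t p q = some x := by
  obtain ⟨t, ht⟩ := (hg.mem_iff _ _ _).1 h
  exact Filter.eventually_atTop.2 ⟨t, fun t' h' => hg.mono h' ht⟩

end reply

/-! ### Listing a set of typical strings -/

/-- The data `(t, s, p, y)` of a stage, a program for an ensemble, a program for a real and a
program for a natural number. -/
abbrev ThresholdData := ℕ × List Bool × List Bool × List Bool

namespace ThresholdData

variable (g : ℕ → List Bool → List Bool → Option (List Bool))

/-- The length given by the third program. -/
def len (z : ThresholdData) : ℕ := reply g z.1 z.2.2.2 []

/-- The integral approximation of the real number. -/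
def realZero (z : ThresholdData) : ℕ := reply g z.1 z.2.2.1 (natCode 0)

/-- The query for the entropy. -/
def entropyQuery (z : ThresholdData) : List Bool := queryCode (none, realZero g z + 1)

/-- The numerator of the approximation of the entropy. -/
def entropyReply (z : ThresholdData) : ℕ := reply g z.1 z.2.1 (entropyQuery g z)

/-- The query for the precise approximation of the real number. -/
def realQuery (z : ThresholdData) : List Bool := natCode (entropyReply g z + 1)

/-- The exponent of the probability threshold. -/
def bound (z : ThresholdData) : ℕ :=
  entropyBound (realZero g z) (entropyReply g z) (reply g z.1 z.2.2.1 (realQuery g z))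

/-- The query for the probability of `a`. -/
def probQuery (z : ThresholdData) (a : List Bool) : List Bool := queryCode (some a, bound g z + 2)

/-- All computations needed at stage `t` have halted. -/
def Ready (z : ThresholdData) : Prop :=
  (((g z.1 z.2.2.2 []).isSome ∧ (g z.1 z.2.1 (queryCode (none, 0))).isSome) ∧
    (g z.1 z.2.2.1 (natCode 0)).isSome ∧ (g z.1 z.2.1 (entropyQuery g z)).isSome ∧
      (g z.1 z.2.2.1 (realQuery g z)).isSome) ∧
    ∀ a ∈ strings (len g z), (g z.1 z.2.1 (probQuery g z a)).isSome

instance (z : ThresholdData) : Decidable (Ready g z) := inferInstanceAs (Decidable (_ ∧ _))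

/-- The strings of the given length whose probability appears to be large. -/
def largeSet (z : ThresholdData) : List (List Bool) :=
  (strings (len g z)).filter fun a => 3 ≤ reply g z.1 z.2.1 (probQuery g z a)

/-- The listing of `largeSet`, once all computations have halted. -/
def output (z : ThresholdData) : Option (List Bool) :=
  if Ready g z then some (listCode (largeSet g z)) else none

variable {g}

theorem primrec_output (hg : IsStaging U g) : Primrec (output g) := by
  have ht : Primrec fun z : ThresholdData => z.1 := Primrec.fst
  have hs : Primrec fun z : ThresholdData => z.2.1 := Primrec.fst.comp Primrec.snd
  have hp : Primrec fun z : ThresholdData => z.2.2.1 :=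
    Primrec.fst.comp (Primrec.snd.comp Primrec.snd)
  have hy : Primrec fun z : ThresholdData => z.2.2.2 :=
    Primrec.snd.comp (Primrec.snd.comp Primrec.snd)
  have hquery : Primrec queryCode := primrec_natCode.comp Primrec.encode
  have hlen : Primrec (len g) := hg.primrec_reply ht hy (Primrec.const _)
  have hr0 : Primrec (realZero g) := hg.primrec_reply ht hp (Primrec.const _)
  have heq : Primrec (entropyQuery g) :=
    hquery.comp ((Primrec.const none).pair (Primrec.succ.comp hr0))
  have her : Primrec (entropyReply g) := hg.primrec_reply ht hs heq
  have hrq : Primrec (realQuery g) := primrec_natCode.comp (Primrec.succ.comp her)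
  have hb : Primrec (bound g) :=
    primrec_entropyBound.comp (hr0.pair (her.pair (hg.primrec_reply ht hp hrq)))
  have hpq : Primrec fun z : List Bool × ThresholdData => probQuery g z.2 z.1 :=
    hquery.comp ((Primrec.option_some.comp Primrec.fst).pair
      (Primrec.succ.comp (Primrec.succ.comp (hb.comp Primrec.snd))))
  have hstr : Primrec fun z : ThresholdData => strings (len g z) := primrec_strings.comp hlen
  have hsome : ∀ {α : Type} [Primcodable α] {o : α → Option (List Bool)}, Primrec o →
      PrimrecPred fun a => (o a).isSome = true := fun ho =>
    PrimrecRel.comp Primrec.eq (Primrec.option_isSome.comp ho) (Primrec.const true)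
  have hready : PrimrecPred (Ready g) := by
    refine PrimrecPred.and (PrimrecPred.and (PrimrecPred.and ?_ ?_)
      (PrimrecPred.and ?_ (PrimrecPred.and ?_ ?_))) ?_
    · exact hsome (hg.comp_primrec ht hy (Primrec.const _))
    · exact hsome (hg.comp_primrec ht hs (Primrec.const _))
    · exact hsome (hg.comp_primrec ht hp (Primrec.const _))
    · exact hsome (hg.comp_primrec ht hs heq)
    · exact hsome (hg.comp_primrec ht hp hrq)
    · have hR : PrimrecRel fun (a : List Bool) (z : ThresholdData) =>
          (g z.1 z.2.1 (probQuery g z a)).isSome = true :=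
        hsome (hg.comp_primrec (ht.comp Primrec.snd) (hs.comp Primrec.snd) hpq)
      exact PrimrecRel.comp (PrimrecRel.forall_mem_list hR) hstr Primrec.id
  refine Primrec.ite hready (Primrec.option_some.comp ?_) (Primrec.const none)
  have hR : PrimrecRel fun (a : List Bool) (z : ThresholdData) =>
      3 ≤ reply g z.1 z.2.1 (probQuery g z a) :=
    PrimrecRel.comp Primrec.nat_le (Primrec.const 3)
      (hg.primrec_reply (ht.comp Primrec.snd) (hs.comp Primrec.snd) hpq)
  exact primrec_natCode.comp (Primrec.encode.comp ((PrimrecRel.listFilter hR).comp hstr Primrec.id))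

variable {s p y : List Bool} {E : PMF (List Bool)} {δ : ℝ≥0} {n : ℕ}

/-- The queries form a chain, each depending on earlier replies. Following one halting answer at a
time leaves finitely many computations, and at a late stage all replies agree with these answers. -/
theorem exists_ready (hg : IsStaging U g) (hs : ComputesEnsemble U s E)
    (hp : ∀ k : ℕ, Approximates U p (natCode k) δ k) (hy : natCode n ∈ U y []) :
    ∃ t, Ready g (t, s, p, y) := by
  obtain ⟨d₀, h1, -⟩ := hp 0
  obtain ⟨e₀, h2, -⟩ := hs.2 0
  obtain ⟨m, h3, -⟩ := hs.2 (d₀ + 1)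
  obtain ⟨d, h4, -⟩ := hp (m + 1)
  have h5 : ∀ᶠ t in Filter.atTop, ∀ a ∈ (strings n).toFinset,
      (g t s (queryCode (some a, entropyBound d₀ m d + 2))).isSome := by
    rw [Filter.eventually_all_finset]
    intro a _
    obtain ⟨k, hk, -⟩ := hs.1 a (entropyBound d₀ m d + 2)
    filter_upwards [hg.eventually_eq hk] with t ht
    simp [ht]
  obtain ⟨t, f0, f1, f2, f3, f4, f5⟩ := ((hg.eventually_eq hy).and ((hg.eventually_eq h1).and
    ((hg.eventually_eq h2).and ((hg.eventually_eq h3).and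
      ((hg.eventually_eq h4).and h5))))).exists
  have g0 : len g (t, s, p, y) = n := reply_eq f0
  have g1 : realZero g (t, s, p, y) = d₀ := reply_eq f1
  have g2 : entropyQuery g (t, s, p, y) = queryCode (none, d₀ + 1) := by rw [entropyQuery, g1]
  have g3 : entropyReply g (t, s, p, y) = m := reply_eq (g2 ▸ f3)
  have g4 : realQuery g (t, s, p, y) = natCode (m + 1) := by rw [realQuery, g3]
  have g5 : bound g (t, s, p, y) = entropyBound d₀ m d := by
    rw [bound, g1, g3, g4]; exact congrArg _ (reply_eq f4)
  refine ⟨t, ⟨⟨by simp [f0], by simp [f2]⟩, by simp [f1], by simp [g2, f3], by simp [g4, f4]⟩, ?_⟩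
  intro a ha
  rw [g0] at ha
  simpa [probQuery, g5] using f5 a (List.mem_toFinset.2 ha)

/-- In units of $2^{-(T+2)}$, where `T` is the bound, a typical string has probability at least 4,
hence reply at least 3; a reply of at least 3 forces probability at least 2, that is $2^{-(T+1)}$.
The claim covers every ready stage because the simulating machine chooses its own. -/
theorem largeSet_spec (hg : IsStaging U g) (hs : ComputesEnsemble U s E)
    (hp : ∀ k : ℕ, Approximates U p (natCode k) δ k) (hy : natCode n ∈ U y []) {t : ℕ}
    (h : Ready g (t, s, p, y)) :
    (∀ a ∈ largeSet g (t, s, p, y), a.length = n) ∧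
      (∀ a : List Bool, a.length = n → IsTypical δ a E → a ∈ largeSet g (t, s, p, y)) ∧
      ((largeSet g (t, s, p, y)).toFinset.card : ℝ) ≤ 2 ^ (entropy E * (1 + (δ : ℝ)) + 6) := by
  obtain ⟨⟨⟨r0, -⟩, r1, r2, r3⟩, r4⟩ := h
  have hlen : len g (t, s, p, y) = n := by
    obtain ⟨x, hx⟩ := Option.isSome_iff_exists.1 r0
    obtain rfl := Part.mem_unique hy (hg.mem_of_eq hx)
    exact reply_eq hx
  rw [hlen] at r4
  obtain ⟨b1, b2⟩ : entropy E * (1 + (δ : ℝ)) ≤ bound g (t, s, p, y) ∧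
      (bound g (t, s, p, y) : ℝ) ≤ entropy E * (1 + (δ : ℝ)) + 5 :=
    entropyBound_spec δ.2 (hg.reply_approx (hp 0) r1) (hg.reply_approx (hs.2 _) r2)
      (hg.reply_approx (hp _) r3)
  set T := bound g (t, s, p, y) with hT
  have happ : ∀ a ∈ strings n, |(E a).toReal -
      (reply g t s (probQuery g (t, s, p, y) a) : ℝ) / 2 ^ (T + 2)| ≤ 1 / 2 ^ (T + 2) :=
    fun a ha => hg.reply_approx (hs.1 a (T + 2)) (r4 a ha)
  have hpow : (0 : ℝ) < 2 ^ (T + 2) := by positivity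
  have hmem : ∀ a, a ∈ largeSet g (t, s, p, y) ↔
      a.length = n ∧ 3 ≤ reply g t s (probQuery g (t, s, p, y) a) := by
    intro a
    rw [largeSet, List.mem_filter, hlen, mem_strings_iff, decide_eq_true_iff]
  refine ⟨fun a ha => ((hmem a).1 ha).1, fun a ha htyp => (hmem a).2 ⟨ha, ?_⟩, ?_⟩
  · have h1 := (abs_le.1 (happ a ((mem_strings_iff _ _).2 ha))).2
    have h2 : ((2 : ℝ) ^ T)⁻¹ ≤ (E a).toReal := by
      refine le_trans ?_ htyp
      rw [← Real.rpow_natCast, ← Real.rpow_neg (by norm_num)]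
      exact Real.rpow_le_rpow_of_exponent_le (by norm_num) (neg_le_neg b1)
    have h3 : ((2 : ℝ) ^ T)⁻¹ = 4 / 2 ^ (T + 2) := by rw [pow_add]; field_simp; norm_num
    rw [h3] at h2
    have h4 : (3 : ℝ) / 2 ^ (T + 2) ≤
        (reply g t s (probQuery g (t, s, p, y) a) : ℝ) / 2 ^ (T + 2) := by
      have : (4 : ℝ) / 2 ^ (T + 2) = 3 / 2 ^ (T + 2) + 1 / 2 ^ (T + 2) := by ring
      linarith
    rw [div_le_div_iff_of_pos_right hpow] at h4
    exact_mod_cast h4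
  · have h1 : ((largeSet g (t, s, p, y)).toFinset.card : ℝ) ≤ 2 ^ (T + 1) := by
      refine card_le_of_le_apply E _ (by positivity) fun a ha => ?_
      obtain ⟨ha, h3⟩ := (hmem a).1 (List.mem_toFinset.1 ha)
      have h1 := (abs_le.1 (happ a ((mem_strings_iff _ _).2 ha))).1
      have h4 : (3 : ℝ) / 2 ^ (T + 2) ≤
          (reply g t s (probQuery g (t, s, p, y) a) : ℝ) / 2 ^ (T + 2) := by
        rw [div_le_div_iff_of_pos_right hpow]; exact_mod_cast h3
      have h5 : ((2 : ℝ) ^ (T + 1))⁻¹ = 3 / 2 ^ (T + 2) - 1 / 2 ^ (T + 2) := by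
        rw [pow_succ _ (T + 1)]; field_simp; norm_num
      linarith
    refine h1.trans ?_
    rw [← Real.rpow_natCast]
    refine Real.rpow_le_rpow_of_exponent_le (by norm_num) ?_
    push_cast
    linarith

end ThresholdData

open ThresholdData in
/-- Programs for an ensemble and for `δ` can be combined to a program that lists, given `n`, a set
of strings containing all `δ`-typical ones of length `n`. -/
theorem IsUniversalPrefixComputer.exists_typicalSet (hU : IsUniversalPrefixComputer U) :
    ∃ c : ℕ, ∀ (s p y : List Bool) (E : PMF (List Bool)) (δ : ℝ≥0) (n : ℕ),
      ComputesEnsemble U s E → (∀ k : ℕ, Approximates U p (natCode k) δ k) →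
      natCode n ∈ U y [] →
      ∃ (q : List Bool) (A : Finset (List Bool)), q.length ≤ s.length + p.length + c ∧
        Lists U q y A ∧ (∀ a ∈ A, a.length = n) ∧
        (∀ a : List Bool, a.length = n → IsTypical δ a E → a ∈ A) ∧
        (A.card : ℝ) ≤ 2 ^ (entropy E * (1 + (δ : ℝ)) + 6) := by
  obtain ⟨g, hg⟩ := exists_isStaging hU.partrec
  have hready : ∀ {z : ThresholdData} {x}, output g z = some x →
      Ready g z ∧ listCode (largeSet g z) = x := by
    intro z x h
    unfold output at h
    split_ifs at h with hr
    exact ⟨hr, by simpa using h⟩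
  obtain ⟨c, hc⟩ := hU.exists_append (fun t s p y => output g (t, s, p, y))
    (primrec_output hg) (queryCode (none, 0)) (fun _ => natCode 0) (by
      intro t s p y x h
      obtain ⟨⟨⟨⟨-, h1⟩, h2, -⟩, -⟩, -⟩ := hready h
      obtain ⟨x₁, h1⟩ := Option.isSome_iff_exists.1 h1
      obtain ⟨x₂, h2⟩ := Option.isSome_iff_exists.1 h2
      exact ⟨(hg.mem_of_eq h1).1, (hg.mem_of_eq h2).1⟩)
  refine ⟨c, fun s p y E δ n hs hp hy => ?_⟩
  obtain ⟨q, hq, h⟩ := hc s p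
  obtain ⟨t, ht⟩ := exists_ready hg hs hp hy
  obtain ⟨t', x', h', hx'⟩ := h t y _ (if_pos ht)
  obtain ⟨hr, rfl⟩ := hready h'
  obtain ⟨h1, h2, h3⟩ := largeSet_spec hg hs hp hy hr
  exact ⟨q, (largeSet g (t', s, p, y)).toFinset, hq, ⟨_, rfl, hx'⟩, by simpa using h1,
    by simpa using h2, h3⟩

/-! ### Relations between the complexities -/

theorem exists_eq_kmssIndex {D : ℝ≥0∞} {x : List Bool} (h : kmssIndex U D x ≠ ⊤) :
    ∃ k : ℕ, kmssIndex U D x = k ∧ structureFn U x k ≠ ⊤ ∧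
      structureFn U x k + (k : ℝ≥0∞) ≤ (stringKStar U x x.length : ℝ≥0∞) + D := by
  classical
  have hex : ∃ k : ℕ, structureFn U x k ≠ ⊤ ∧
      structureFn U x k + (k : ℝ≥0∞) ≤ (stringKStar U x x.length : ℝ≥0∞) + D := by
    by_contra hne
    push Not at hne
    refine h (iInf₂_eq_top.2 fun k hk => absurd hk.2 (not_le.2 (hne k hk.1)))
  refine ⟨Nat.find hex, le_antisymm (iInf₂_le (Nat.find hex) (Nat.find_spec hex)) ?_, Nat.find_spec hex⟩
  exact le_iInf₂ fun k hk => by exact_mod_cast Nat.find_min' hex hk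

theorem logCard_mono {A B : Finset (List Bool)} (hA : A.Nonempty) (h : A.card ≤ B.card) :
    logCard A ≤ logCard B := by
  refine ENNReal.ofReal_le_ofReal (Real.logb_le_logb_of_le (by norm_num) ?_ (by exact_mod_cast h))
  exact_mod_cast hA.card_pos

/-- The infimum is attained at a set of least cardinality; among the minimizers the least encoding
exists by well-foundedness. -/
theorem exists_isStructureSet {x : List Bool} {k : ℕ} (h : structureFn U x k ≠ ⊤) :
    ∃ A, IsStructureSet U x k A := by
  have hne : (structureSets U x k).Nonempty := by
    by_contra hS
    rw [Set.not_nonempty_iff_eq_empty] at hS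
    exact h (by simp [structureFn, hS])
  obtain ⟨B, hB, hBmin⟩ := WellFounded.has_min
    (measure (Finset.card (α := List Bool))).wf _ hne
  have hBeq : logCard B = structureFn U x k :=
    le_antisymm (le_iInf₂ fun A hA => logCard_mono ⟨x, hB.1⟩ (not_lt.1 (hBmin A hA)))
      (iInf₂_le B hB)
  obtain ⟨A, hA, hAmin⟩ := WellFounded.has_min
    (measure (Encodable.encode : Finset (List Bool) → ℕ)).wf
    {A | A ∈ structureSets U x k ∧ logCard A = structureFn U x k} ⟨B, hB, hBeq⟩
  exact ⟨A, hA.1, hA.2, fun A' h h' => not_lt.1 (hAmin A' ⟨h, h'⟩)⟩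

theorem IsUniversalPrefixComputer.kmssLength_le (hU : IsUniversalPrefixComputer U) :
    ∃ c : ℕ, ∀ (D : ℝ≥0∞) (x : List Bool),
      kmssLength U D x ≤ kmssIndex U D x + natK U x.length + (c : ℕ∞) := by
  obtain ⟨c, hc⟩ := hU.exists_comp
  refine ⟨c, fun D x => ?_⟩
  by_cases htop : kmssIndex U D x = ⊤
  · simp [htop]
  obtain ⟨k, hk, hfin, -⟩ := exists_eq_kmssIndex htop
  obtain ⟨A, hA⟩ := exists_isStructureSet hfin
  obtain ⟨p, ⟨s, hs, l, hl, hp⟩, hpl, -⟩ := exists_length_eq_minLength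
    (ne_top_of_le_ne_top (ENat.natCast_ne_top k) hA.1.2.2)
  obtain ⟨q, hq, hqU⟩ := hc s p hs.1.1
  have hqA : q ∈ {q | Lists U q [] A} := ⟨l, hl, hqU _ hp⟩
  obtain ⟨r, hr, -, hrmin⟩ := exists_length_eq_minLength
    (ne_top_of_le_ne_top (ENat.natCast_ne_top _) (minLength_le hqA))
  have hpk : (p.length : ℕ∞) ≤ k := hpl.le.trans hA.1.2.2
  calc kmssLength U D x ≤ r.length := minLength_le ⟨k, A, hk, hA, hr, hrmin⟩
    _ ≤ q.length := by exact_mod_cast hrmin q hqA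
    _ ≤ p.length + s.length + c := by rw [add_comm (p.length : ℕ∞)]; exact_mod_cast hq
    _ ≤ kmssIndex U D x + natK U x.length + c := by
        rw [hk, natK, ← hs.length_eq]; gcongr

theorem IsUniversalPrefixComputer.stringK_le (hU : IsUniversalPrefixComputer U) :
    ∃ c : ℕ, ∀ x : List Bool,
      stringK U x ≤ stringKStar U x x.length + natK U x.length + (c : ℕ∞) := by
  obtain ⟨c, hc⟩ := hU.exists_comp
  refine ⟨c, fun x => ?_⟩
  by_cases htop : stringKStar U x x.length = ⊤
  · simp [htop]
  obtain ⟨p, ⟨s, hs, hp⟩, hpl, -⟩ := exists_length_eq_minLength htop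
  obtain ⟨q, hq, hqU⟩ := hc s p hs.1.1
  calc stringK U x ≤ q.length := minLength_le (hqU _ hp)
    _ ≤ p.length + s.length + c := by rw [add_comm (p.length : ℕ∞)]; exact_mod_cast hq
    _ = stringKStar U x x.length + natK U x.length + c := by
        rw [natK, ← hs.length_eq, hpl, stringKStar]

/-- The hard half of the chain rule. -/
theorem IsUniversalPrefixComputer.stringKStar_add_natK_le (hU : IsUniversalPrefixComputer U) :
    ∃ c : ℕ, ∀ x : List Bool,
      stringKStar U x x.length + natK U x.length ≤ stringK U x + (c : ℕ∞) := by
  obtain ⟨c, hc⟩ := hU.exists_conditional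
  refine ⟨c, fun x => ?_⟩
  obtain ⟨p, hp, hpl, -⟩ := exists_length_eq_minLength (hU.stringK_ne_top x)
  obtain ⟨s, hs⟩ := hU.exists_isStar (natCode x.length)
  obtain ⟨q, hq, hqU⟩ := hc x s p hs hp
  calc stringKStar U x x.length + natK U x.length ≤ q.length + s.length := by
        rw [natK, ← hs.length_eq]
        gcongr
        exact minLength_le ⟨s, hs, hqU⟩
    _ ≤ p.length + c := by exact_mod_cast hq
    _ = stringK U x + c := by rw [hpl, stringK]

theorem logCard_eq_entropy (A : Finset (List Bool)) (hA : A.Nonempty) :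
    logCard A = ENNReal.ofReal (entropy (PMF.uniformOfFinset A hA)) := by
  rw [entropy_uniformOfFinset, logCard]

theorem isTypical_uniformOfFinset (δ : ℝ≥0) (A : Finset (List Bool)) (hA : A.Nonempty)
    {x : List Bool} (hx : x ∈ A) : IsTypical δ x (PMF.uniformOfFinset A hA) := by
  have hc : (0 : ℝ) < A.card := by exact_mod_cast hA.card_pos
  rw [IsTypical, PMF.uniformOfFinset_apply, if_pos hx, ENNReal.toReal_inv,
    ENNReal.toReal_natCast]
  conv_rhs => rw [← Real.rpow_logb (b := 2) (by norm_num) (by norm_num) hc]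
  rw [← Real.rpow_neg (by norm_num)]
  refine Real.rpow_le_rpow_of_exponent_le (by norm_num) (neg_le_neg ?_)
  have h0 := entropy_nonneg (PMF.uniformOfFinset A hA)
  rw [entropy_uniformOfFinset] at h0 ⊢
  nlinarith [mul_nonneg h0 δ.2]

theorem IsUniversalPrefixComputer.effComplexity_le_kmssLength (hU : IsUniversalPrefixComputer U) :
    ∃ c C : ℕ, ∀ (δ Δ : ℝ≥0) (x : List Bool),
      effComplexity U δ (Δ + (c : ℝ≥0)) x ≤ kmssLength U (Δ : ℝ≥0∞) x + (C : ℕ∞) := by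
  obtain ⟨c₁, h₁⟩ := hU.exists_uniform
  obtain ⟨c₂, h₂⟩ := hU.kmssLength_le
  obtain ⟨c₃, h₃⟩ := hU.stringKStar_add_natK_le
  -- The slack collects the cost of passing from a set to its uniform ensemble, of prepending $n^*$
  -- to a conditional program, and of the chain rule.
  refine ⟨c₁ + c₂ + c₃, c₁, fun δ Δ x => ?_⟩
  by_cases htop : kmssLength U (Δ : ℝ≥0∞) x = ⊤
  · simp [htop]
  obtain ⟨p, ⟨k, A, hk, hA, hp, -⟩, hpl, -⟩ := exists_length_eq_minLength htop
  have hxA : x ∈ A := hA.1.1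
  have hne : A.Nonempty := ⟨x, hxA⟩
  obtain ⟨q, hq, hqE⟩ := h₁ p A hne hp
  have hEH := logCard_eq_entropy A hne
  have hEtyp := isTypical_uniformOfFinset δ A hne hxA
  have hEsum := summable_entropyTerm_uniformOfFinset A hne
  generalize PMF.uniformOfFinset A hne = E at hqE hEH hEtyp hEsum
  have hEq : ensembleK U E ≤ q.length := minLength_le hqE
  have hEp : ensembleK U E ≤ p.length + c₁ := hEq.trans (by exact_mod_cast hq)
  have hpk : (p.length : ℕ∞) ≤ k + natK U x.length + c₂ := by
    rw [hpl, ← hk]; exact h₂ _ x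
  obtain ⟨k', hk', -, hsum⟩ := exists_eq_kmssIndex (hk ▸ ENat.natCast_ne_top k)
  obtain rfl : k = k' := by exact_mod_cast hk.symm.trans hk'
  have hmem : E ∈ minDomain U δ (Δ + ((c₁ + c₂ + c₃ : ℕ) : ℝ≥0)) x := by
    refine ⟨hEsum, ne_top_of_le_ne_top (ENat.natCast_ne_top _) hEq, hEtyp, ?_⟩
    have e1 : (ensembleK U E : ℝ≥0∞) ≤ (p.length : ℝ≥0∞) + c₁ := by
      simpa using ENat.toENNReal_le.2 hEp
    have e2 : (p.length : ℝ≥0∞) ≤ k + (natK U x.length : ℝ≥0∞) + c₂ := by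
      simpa using ENat.toENNReal_le.2 hpk
    have e3 : (stringKStar U x x.length : ℝ≥0∞) + (natK U x.length : ℝ≥0∞) ≤
        (stringK U x : ℝ≥0∞) + c₃ := by
      simpa using ENat.toENNReal_le.2 (h₃ x)
    rw [totalInfo, ← hEH, hA.2.1]
    calc (ensembleK U E : ℝ≥0∞) + structureFn U x k
        ≤ (k + (natK U x.length : ℝ≥0∞) + c₂ + c₁) + structureFn U x k := by
          gcongr; exact e1.trans (by gcongr)
      _ = (structureFn U x k + k) + ((natK U x.length : ℝ≥0∞) + c₂ + c₁) := by ring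
      _ ≤ ((stringKStar U x x.length : ℝ≥0∞) + Δ) + ((natK U x.length : ℝ≥0∞) + c₂ + c₁) := by
          gcongr
      _ = ((stringKStar U x x.length : ℝ≥0∞) + (natK U x.length : ℝ≥0∞)) + Δ + c₂ + c₁ := by ring
      _ ≤ ((stringK U x : ℝ≥0∞) + c₃) + Δ + c₂ + c₁ := by gcongr
      _ = _ := by push_cast; ring
  calc effComplexity U δ (Δ + ((c₁ + c₂ + c₃ : ℕ) : ℝ≥0)) x ≤ ensembleK U E := iInf₂_le E hmem
    _ ≤ p.length + c₁ := hEp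
    _ = _ := by rw [hpl, kmssLength]

theorem logCard_le {A : Finset (List Bool)} (hA : A.Nonempty) {E : PMF (List Bool)} {δ : ℝ≥0}
    (h : (A.card : ℝ) ≤ 2 ^ (entropy E * (1 + (δ : ℝ)) + 6)) :
    logCard A ≤ ENNReal.ofReal (entropy E) * (1 + δ) + 6 := by
  have h0 := entropy_nonneg E
  have hc : (0 : ℝ) < A.card := by exact_mod_cast hA.card_pos
  calc logCard A ≤ ENNReal.ofReal (entropy E * (1 + (δ : ℝ)) + 6) := by
        refine ENNReal.ofReal_le_ofReal ?_
        rwa [Real.logb_le_iff_le_rpow (by norm_num) hc]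
    _ = _ := by
        rw [ENNReal.ofReal_add (mul_nonneg h0 (by positivity)) (by norm_num),
          ENNReal.ofReal_mul h0, ENNReal.ofReal_add zero_le_one δ.coe_nonneg]
        simp

theorem IsUniversalPrefixComputer.kmssIndex_le_effComplexity (hU : IsUniversalPrefixComputer U) :
    ∃ g C : ℕ, ∀ (δ Δ : ℝ≥0) (x : List Bool) (D : ℝ≥0∞),
      D = (natK U x.length : ℝ≥0∞) + (Δ : ℝ≥0∞) +
          (δ : ℝ≥0∞) * ((stringK U x : ℝ≥0∞) + (Δ : ℝ≥0∞)) +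
          (realK U (δ : ℝ) : ℝ≥0∞) + (g : ℝ≥0∞) →
      kmssIndex U D x ≤ effComplexity U δ Δ x + realK U (δ : ℝ) + (C : ℕ∞) := by
  obtain ⟨c, hc⟩ := hU.exists_typicalSet
  obtain ⟨d, hd⟩ := hU.stringK_le
  -- The 6 comes from the size of the typical set, `c` from combining the programs for the ensemble
  -- and for `δ`, and `d` from the easy half of the chain rule.
  refine ⟨6 + c + d, c, fun δ Δ x D hD => ?_⟩
  by_cases hδ : realK U (δ : ℝ) = ⊤
  · simp [hδ]
  obtain ⟨p, hp, hpl, -⟩ := exists_length_eq_minLength hδ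
  replace hpl : (p.length : ℕ∞) = realK U (δ : ℝ) := hpl
  by_cases htop : effComplexity U δ Δ x = ⊤
  · simp [htop]
  have hne : (minDomain U δ Δ x).Nonempty := by
    by_contra hS
    rw [Set.not_nonempty_iff_eq_empty] at hS
    exact htop (by simp [effComplexity, hS])
  have key : ∀ E ∈ minDomain U δ Δ x, kmssIndex U D x ≤ ensembleK U E + p.length + c := by
    rintro E ⟨-, hEK, htyp, htot⟩
    obtain ⟨s, hs, hsl, -⟩ := exists_length_eq_minLength hEK
    replace hsl : (s.length : ℕ∞) = ensembleK U E := hsl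
    obtain ⟨y, hy⟩ := hU.exists_isStar (natCode x.length)
    obtain ⟨q, A, hq, hqA, hlen, hA, hcard⟩ := hc s p y E δ x.length hs hp hy.1
    have hxA : x ∈ A := hA x rfl htyp
    have hAk : A ∈ structureSets U x (s.length + p.length + c) := by
      have hq' : setKStar U A x.length ≤ q.length :=
        minLength_le (S := {p | ∃ s, IsStar U _ s ∧ Lists U p s A}) ⟨y, hy, hqA⟩
      exact ⟨hxA, hlen, hq'.trans (by exact_mod_cast hq)⟩
    have hfn : structureFn U x (s.length + p.length + c) ≤ logCard A := iInf₂_le A hAk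
    have hlog := logCard_le ⟨x, hxA⟩ hcard
    rw [← hsl]
    have hgoal : kmssIndex U D x ≤ ((s.length + p.length + c : ℕ) : ℕ∞) := by
      refine iInf₂_le _ ⟨ne_top_of_le_ne_top ENNReal.ofReal_ne_top hfn, ?_⟩
      set h := ENNReal.ofReal (entropy E) with hh
      have e1 : (s.length : ℝ≥0∞) + h ≤ (stringK U x : ℝ≥0∞) + Δ := by
        have := htot
        rw [totalInfo, ← hsl] at this
        simpa using this
      -- This bound on the entropy turns the excess $\delta H$ into the term $\delta(K(x)+\Delta)$
      -- of `D`.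
      have e2 : h ≤ (stringK U x : ℝ≥0∞) + Δ := le_add_self.trans e1
      have e3 : (stringK U x : ℝ≥0∞) ≤
          (stringKStar U x x.length : ℝ≥0∞) + (natK U x.length : ℝ≥0∞) + d := by
        simpa using ENat.toENNReal_le.2 (hd x)
      calc structureFn U x (s.length + p.length + c) + ((s.length + p.length + c : ℕ) : ℝ≥0∞)
          ≤ (h * (1 + δ) + 6) + ((s.length + p.length + c : ℕ) : ℝ≥0∞) := by
            gcongr; exact hfn.trans hlog
        _ = ((s.length : ℝ≥0∞) + h) + δ * h + p.length + (6 + c) := by push_cast; ring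
        _ ≤ ((stringK U x : ℝ≥0∞) + Δ) + δ * ((stringK U x : ℝ≥0∞) + Δ) + p.length + (6 + c) := by
            gcongr
        _ ≤ (((stringKStar U x x.length : ℝ≥0∞) + (natK U x.length : ℝ≥0∞) + d) + Δ) +
              δ * ((stringK U x : ℝ≥0∞) + Δ) + p.length + (6 + c) := by
            gcongr
        _ = (stringKStar U x x.length : ℝ≥0∞) + D := by
            rw [hD, ← hpl, ENat.toENNReal_coe]; push_cast; ring
    exact_mod_cast hgoal
  rw [← hpl]
  -- The infimum is attained because `ℕ∞` is well-ordered.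
  obtain ⟨E, hE, hEeq⟩ : ∃ E ∈ minDomain U δ Δ x, effComplexity U δ Δ x = ensembleK U E := by
    obtain ⟨E, hE, hmin⟩ := WellFounded.has_min
      (InvImage.wf (ensembleK U) wellFounded_lt) _ hne
    exact ⟨E, hE, le_antisymm (iInf₂_le E hE) (le_iInf₂ fun E' hE' => not_lt.1 (hmin E' hE'))⟩
  rw [hEeq]
  exact key E hE

end EffComp

theorem mainTheorem6 (U : List Bool → List Bool →. List Bool)
    (hU : EffComp.IsUniversalPrefixComputer U) :
    (∃ c C : ℕ, ∀ (δ Δ : ℝ≥0) (x : List Bool),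
      EffComp.effComplexity U δ (Δ + (c : ℝ≥0)) x ≤
          EffComp.kmssLength U (Δ : ℝ≥0∞) x + (C : ℕ∞) ∧
        EffComp.kmssLength U (Δ : ℝ≥0∞) x ≤
          EffComp.kmssIndex U (Δ : ℝ≥0∞) x + EffComp.natK U x.length + (C : ℕ∞)) ∧
    (∃ g C : ℕ, ∀ (δ Δ : ℝ≥0) (x : List Bool) (D : ℝ≥0∞),
      D = (EffComp.natK U x.length : ℝ≥0∞) + (Δ : ℝ≥0∞) +
          (δ : ℝ≥0∞) * ((EffComp.stringK U x : ℝ≥0∞) + (Δ : ℝ≥0∞)) +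
          (EffComp.realK U (δ : ℝ) : ℝ≥0∞) + (g : ℝ≥0∞) →
      EffComp.kmssIndex U D x ≤
          EffComp.effComplexity U δ Δ x + EffComp.realK U (δ : ℝ) + (C : ℕ∞) ∧
        EffComp.kmssLength U D x ≤
          EffComp.kmssIndex U D x + EffComp.natK U x.length + (C : ℕ∞)) := by
  obtain ⟨a, ha⟩ := hU.kmssLength_le
  obtain ⟨c, C, hc⟩ := hU.effComplexity_le_kmssLength
  obtain ⟨g, C', hg⟩ := hU.kmssIndex_le_effComplexity
  refine ⟨⟨c, C + a, fun δ Δ x => ⟨(hc δ Δ x).trans ?_, (ha _ x).trans ?_⟩⟩,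
    g, C' + a, fun δ Δ x D hD => ⟨(hg δ Δ x D hD).trans ?_, (ha _ x).trans ?_⟩⟩ <;>
  · gcongr
    omega
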